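/- Let $M$ be a smooth manifold of dimension $m$ (Hausdorff, $\sigma$-compact, without boundary) and let $\mathcal W_\Omega=(M,\mathcal F_1,\dots,\mathcal F_n,\Omega)$ be a divergence-free $n$-web: $\mathcal F_1,\dots,\mathcal F_n$ are foliations of $M$ with $\operatorname{codim}\bigcap_{i}T_p\mathcal F_i=\sum_{i}\operatorname{codim}T_p\mathcal F_i$ for all $p\in M$ and $\sum_i\operatorname{codim}\mathcal F_i=m$, and $\Omega$ is a nowhere vanishing smooth $m$-form on $M$. For each $i$ let $\mathcal F_i^c$ be the foliation with tangent distribution $T\mathcal F_i^c=\bigcap_{j\ne i}T\mathcal F_j$, so that $TM=T\mathcal F_i^c\oplus T\mathcal F_i$; for a foliation $\mathcal F$ write $\det T\mathcal F$ for the line bundle of top-degree multivectors in $T\mathcal F$. A $\mathcal W_\Omega$-connection is a smooth torsionless affine connection $\Theta$ on $M$ for which all $\mathcal F_i$ and $\Omega$ are parallel. The natural connection $\omega$ of $\mathcal W_\Omega$ is the linear connection on $\bigoplus_{i=1}^n\det T\mathcal F_i^c$ induced, through the Leibniz rule $\Theta_X(Y_1\wedge\dots\wedge Y_d)=\sum_j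 Y_1\wedge\dots\wedge\Theta_XY_j\wedge\dots\wedge Y_d$, by the action of any $\mathcal W_\Omega$-connection $\Theta$ on vector fields. For a divergence-free $2$-web $(M,\mathcal F,\mathcal G,\Omega)$ write $X=X_{\mathcal F}+X_{\mathcal G}$ for the decomposition of a vector field along $TM=T\mathcal F\oplus T\mathcal G$. Bott's partial connection $D^{\mathcal F}_X\bar Y=[X,Y]\bmod T\mathcal F$ ($X\in\Gamma(T\mathcal F)$, $\bar Y\in\Gamma(TM/T\mathcal F)$ represented by $Y$) acts on $T\mathcal G\cong TM/T\mathcal F$ along $T\mathcal F$ and extends by the Leibniz rule to $\det T\mathcal G$ and its dual $\det T^*\mathcal G$; likewise $D^{\mathcal G}$ acts on $\det T\mathcal F$ along $T\mathcal G$. Let $\mu:\det T\mathcal F\to\det T^*\mathcal G$ be the isomorphism $\eta\mapsto\eta\mathbin{\lrcorner}\Omega$. Tabachnikov's connection on $\det T\mathcal F$ is $$\nabla_X\eta=\mu^{-1}D^{\mathcal F}_{X_{\mathcal F}}(\mu\eta)+D^{\mathcal G}_{X_{\mathcal G}}\eta .$$ Then the natural connection $\omega$ of $\mathcal W_\Omega$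 exists (there is a $\mathcal W_\Omega$-connection, and the induced connection does not depend on its choice), and for each $i=1,\dots,n$ Tabachnikov's connection $\nabla^i$ on $\det T\mathcal F_i^c$ of the divergence-free $2$-web $(M,\mathcal F_i^c,\mathcal F_i,\Omega)$ exists, and the restriction of $\omega$ to $\det T\mathcal F_i^c$ is exactly $\nabla^i$: for all smooth vector fields $X$ on $M$ and all smooth sections $\eta$ of $\det T\mathcal F_i^c$, the $\omega$-covariant derivative of $\eta$ along $X$ is $\nabla^i_X\eta$. -/

import Mathlib

open scoped Manifold ContDiff

/-! ### Linear algebra: contraction with a volume form -/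

section LinearAlgebra

variable {V : Type*} [AddCommGroup V] [Module ℝ V]

/-- The contraction `η ↦ η ⌟ Ω` of `η ∈ ⋀ᵖ A`, for a subspace `A` of `V`, with an `m`-form `Ω`
on `V`, restricted to a subspace `B`: `(η ⌟ Ω)(w₁, …, w_q) = Ω(η ∧ w₁ ∧ ⋯ ∧ w_q)` for `wⱼ ∈ B`.
Here `Ω` is seen as a linear functional on the exterior algebra of `V` which vanishes in the
degrees other than `m`. -/
noncomputable def contraction {m : ℕ} (Ω : V [⋀^Fin m]→ₗ[ℝ] ℝ) (A B : Submodule ℝ V) (p q : ℕ) :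
    (⋀[ℝ]^p A) →ₗ[ℝ] (B [⋀^Fin q]→ₗ[ℝ] ℝ) where
  toFun η :=
    ((ExteriorAlgebra.liftAlternating (R := ℝ) (M := V) (N := ℝ) (Pi.single m Ω) ∘ₗ
      LinearMap.mulLeft ℝ (ExteriorAlgebra.map A.subtype (η : ExteriorAlgebra ℝ A))
      ).compAlternatingMap (ExteriorAlgebra.ιMulti ℝ q)).compLinearMap B.subtype
  map_add' η η' := by
    ext w
    simp [add_mul]
  map_smul' a η := by
    ext w
    simp

theorem contraction_ιMulti {p q : ℕ} (Ω : V [⋀^Fin (p + q)]→ₗ[ℝ] ℝ) (A B : Submodule ℝ V)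
    (v : Fin p → A) (w : Fin q → B) :
    contraction Ω A B p q (exteriorPower.ιMulti ℝ p v) w =
      Ω (Fin.append (fun j => (v j : V)) (fun j => (w j : V))) := by
  have h1 : ExteriorAlgebra.map A.subtype (ExteriorAlgebra.ιMulti ℝ p v) =
      ExteriorAlgebra.ιMulti ℝ p (fun j => (v j : V)) := by
    rw [ExteriorAlgebra.map_apply_ιMulti]; rfl
  have h2 : (B.subtype ∘ w) = fun j => (w j : V) := rfl
  simp [contraction, h1, ExteriorAlgebra.ιMulti_mul_ιMulti,
    ExteriorAlgebra.liftAlternating_apply_ιMulti]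

theorem contraction_bijective [FiniteDimensional ℝ V] {m p q : ℕ} (Ω : V [⋀^Fin m]→ₗ[ℝ] ℝ)
    (hΩ : Ω ≠ 0) (A B : Submodule ℝ V) (h : IsCompl A B) (hm : Module.finrank ℝ V = m)
    (hp : Module.finrank ℝ A = p) (hq : Module.finrank ℝ B = q) :
    Function.Bijective (contraction Ω A B p q) := by
  have hpq : p + q = m := by
    rw [← hp, ← hq, ← hm]; exact Submodule.finrank_add_eq_of_isCompl h
  subst hpq
  have e1 : Module.finrank ℝ (⋀[ℝ]^p A) = 1 := by rw [exteriorPower.finrank_eq, hp]; simp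
  have e2 : Module.finrank ℝ (B [⋀^Fin q]→ₗ[ℝ] ℝ) = 1 := by
    rw [(exteriorPower.alternatingMapLinearEquiv (R := ℝ) (M := B) (N := ℝ) (n := q)).finrank_eq]
    have : Module.finrank ℝ (⋀[ℝ]^q B →ₗ[ℝ] ℝ) = Module.finrank ℝ (⋀[ℝ]^q B) :=
      Subspace.dual_finrank_eq
    rw [this, exteriorPower.finrank_eq, hq]; simp
  have f2 : FiniteDimensional ℝ (B [⋀^Fin q]→ₗ[ℝ] ℝ) :=
    Module.finite_of_finrank_pos (by omega)
  have hne : contraction Ω A B p q ≠ 0 := by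
    intro h0
    let a : Module.Basis (Fin p) ℝ A := Module.finBasisOfFinrankEq ℝ A hp
    let b : Module.Basis (Fin q) ℝ B := Module.finBasisOfFinrankEq ℝ B hq
    let c : Module.Basis (Fin (p + q)) ℝ V :=
      ((a.prod b).map (Submodule.prodEquivOfIsCompl A B h)).reindex finSumFinEquiv
    have hc : (c : Fin (p + q) → V) = Fin.append (fun j => (a j : V)) (fun j => (b j : V)) := by
      funext k
      refine Fin.addCases (fun i => ?_) (fun i => ?_) k <;> simp [c]
    apply hΩ
    refine c.ext_alternating fun v hv => ?_
    have hz : Ω (fun i => c i) = 0 := by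
      have := contraction_ιMulti Ω A B a b
      rw [h0] at this
      rw [show (fun i => c i) = (c : Fin (p + q) → V) from rfl, hc, ← this]; rfl
    let σ : Equiv.Perm (Fin (p + q)) := Equiv.ofBijective v (Finite.injective_iff_bijective.mp hv)
    have := Ω.map_perm (fun i => c i) σ
    rw [hz] at this
    simpa [σ, Function.comp_def] using this
  have hinj : Function.Injective (contraction Ω A B p q) := by
    obtain ⟨η, hη⟩ : ∃ η, contraction Ω A B p q η ≠ 0 := by
      by_contra! hcon
      exact hne (LinearMap.ext hcon)
    rw [← LinearMap.ker_eq_bot, Submodule.eq_bot_iff]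
    intro ζ hζ
    have hη0 : η ≠ 0 := by rintro rfl; simp at hη
    obtain ⟨r, rfl⟩ := (finrank_eq_one_iff_of_nonzero' η hη0).mp e1 ζ
    have : r = 0 := by simpa [hη] using hζ
    simp [this]
  exact ⟨hinj, (LinearMap.injective_iff_surjective_of_finrank_eq_finrank (by rw [e1, e2])).mp hinj⟩

theorem finrank_le_finrank_iInf_add [FiniteDimensional ℝ V] {ι : Type*} [Fintype ι]
    (T : ι → Submodule ℝ V) (c : ι → ℕ)
    (h : ∀ i, Module.finrank ℝ V ≤ Module.finrank ℝ (T i) + c i) :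
    Module.finrank ℝ V ≤ Module.finrank ℝ (⨅ i, T i : Submodule ℝ V) + ∑ i, c i := by
  classical
  have key : ∀ s : Finset ι, Module.finrank ℝ V ≤
      Module.finrank ℝ (⨅ i ∈ s, T i : Submodule ℝ V) + ∑ i ∈ s, c i := by
    intro s
    induction s using Finset.induction_on with
    | empty =>
      have h0 : (⨅ i ∈ (∅ : Finset ι), T i) = ⊤ := by simp
      rw [h0, finrank_top]
      exact Nat.le_add_right _ _
    | insert a s ha ih =>
      rw [Finset.iInf_insert, Finset.sum_insert ha]
      have h1 := Submodule.finrank_sup_add_finrank_inf_eq (T a) (⨅ i ∈ s, T i)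
      have h2 := Submodule.finrank_le (T a ⊔ ⨅ i ∈ s, T i)
      have h3 := h a
      omega
  have hu : (⨅ i ∈ Finset.univ, T i) = ⨅ i, T i := by simp
  have := key Finset.univ
  rwa [hu] at this

end LinearAlgebra

/-! ### Smooth fields and forms -/

section Manifold

variable {E : Type*} [NormedAddCommGroup E] [NormedSpace ℝ E]
  {M : Type*} [TopologicalSpace M] [ChartedSpace E M]

/-- The vector field `X` is smooth on `U`. -/
def IsSmoothFieldOn [IsManifold 𝓘(ℝ, E) ∞ M] (X : Π x : M, TangentSpace 𝓘(ℝ, E) x)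
    (U : Set M) : Prop :=
  ContMDiffOn 𝓘(ℝ, E) (𝓘(ℝ, E).prod 𝓘(ℝ, E)) ∞ (fun x => (⟨x, X x⟩ : TangentBundle 𝓘(ℝ, E) M)) U

/-- The real function `f` is smooth on `U`. -/
def IsSmoothFunOn (f : M → ℝ) (U : Set M) : Prop :=
  ContMDiffOn 𝓘(ℝ, E) 𝓘(ℝ, ℝ) ∞ f U

/-- The derivative `X f` of the function `f` along the vector field `X`. -/
noncomputable def lieDer (X : Π x : M, TangentSpace 𝓘(ℝ, E) x) (f : M → ℝ) (x : M) : ℝ :=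
  mvfderiv 𝓘(ℝ, E) f x (X x)

/-- The `1`-form `ξ` is smooth on the open set `U`: its values on smooth fields are smooth. -/
def IsSmoothOneFormOn [IsManifold 𝓘(ℝ, E) ∞ M]
    (ξ : Π x : M, Module.Dual ℝ (TangentSpace 𝓘(ℝ, E) x)) (U : Set M) : Prop :=
  ∀ U' : Set M, IsOpen U' → U' ⊆ U → ∀ X : Π x : M, TangentSpace 𝓘(ℝ, E) x,
    IsSmoothFieldOn X U' → IsSmoothFunOn (E := E) (fun x => ξ x (X x)) U'

/-- A volume form: a smooth nowhere vanishing form of top degree. Smoothness means that its values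
on smooth vector fields are smooth. -/
structure VolumeForm (E : Type*) [NormedAddCommGroup E] [NormedSpace ℝ E]
    (M : Type*) [TopologicalSpace M] [ChartedSpace E M] [IsManifold 𝓘(ℝ, E) ∞ M] where
  toForm : Π x : M, (TangentSpace 𝓘(ℝ, E) x) [⋀^Fin (Module.finrank ℝ E)]→ₗ[ℝ] ℝ
  smooth : ∀ U : Set M, IsOpen U →
    ∀ X : Fin (Module.finrank ℝ E) → Π x : M, TangentSpace 𝓘(ℝ, E) x,
    (∀ j, IsSmoothFieldOn (X j) U) →
      IsSmoothFunOn (E := E) (fun x => toForm x (fun j => X j x)) U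
  ne_zero : ∀ x, toForm x ≠ 0

/-! ### Foliations -/

/-- A (regular, smooth) foliation, given by its tangent distribution: a smooth involutive
distribution of constant rank. -/
structure Foliation (E : Type*) [NormedAddCommGroup E] [NormedSpace ℝ E]
    (M : Type*) [TopologicalSpace M] [ChartedSpace E M] [IsManifold 𝓘(ℝ, E) ∞ M] where
  /-- the tangent space of the leaf through `x` -/
  tangent : Π x : M, Submodule ℝ (TangentSpace 𝓘(ℝ, E) x)
  /-- the dimension of the leaves -/
  dim : ℕ
  /-- the codimension of the leaves -/
  codim : ℕ
  dim_add_codim : dim + codim = Module.finrank ℝ E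
  finrank_tangent : ∀ x, Module.finrank ℝ (tangent x) = dim
  /-- locally, the distribution is the common kernel of `codim` smooth `1`-forms -/
  smooth : ∀ x₀ : M, ∃ U : Set M, IsOpen U ∧ x₀ ∈ U ∧
    ∃ ξ : Fin codim → Π x : M, Module.Dual ℝ (TangentSpace 𝓘(ℝ, E) x),
      (∀ j, IsSmoothOneFormOn (ξ j) U) ∧ ∀ x ∈ U, tangent x = ⨅ j, LinearMap.ker (ξ j x)
  involutive : ∀ U : Set M, IsOpen U → ∀ X Y : Π x : M, tangent x,
    IsSmoothFieldOn (fun x => (X x : TangentSpace 𝓘(ℝ, E) x)) U →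
    IsSmoothFieldOn (fun x => (Y x : TangentSpace 𝓘(ℝ, E) x)) U →
    ∀ x ∈ U, VectorField.mlieBracket 𝓘(ℝ, E) (fun y => (X y : TangentSpace 𝓘(ℝ, E) y))
      (fun y => (Y y : TangentSpace 𝓘(ℝ, E) y)) x ∈ tangent x

namespace Foliation

variable [IsManifold 𝓘(ℝ, E) ∞ M]

/-- Vector fields tangent to the foliation. -/
abbrev Field (F : Foliation E M) : Type _ := Π x : M, F.tangent x

/-- A field tangent to the foliation, as a vector field on `M`. -/
def Field.toVF {F : Foliation E M} (X : F.Field) : Π x : M, TangentSpace 𝓘(ℝ, E) x :=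
  fun x => (X x : TangentSpace 𝓘(ℝ, E) x)

/-- The fibre at `x` of the determinant bundle `det TF`: multivectors of top degree in `T_x F`. -/
abbrev Det (F : Foliation E M) (x : M) : Type _ := ⋀[ℝ]^F.dim (F.tangent x)

/-- The fibre at `x` of `det T*F`: forms of top degree on `T_x F`. -/
abbrev DetDual (F : Foliation E M) (x : M) : Type _ := (F.tangent x) [⋀^Fin F.dim]→ₗ[ℝ] ℝ

/-- On the open set `U`, the section `η` of `det TF` is written as `f · Y₁ ∧ ⋯ ∧ Y_d` with a smooth
function `f` and smooth fields `Y₁, …, Y_d` tangent to `F`. -/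
structure IsLocalExpr (F : Foliation E M) (η : Π x : M, F.Det x) (U : Set M) (f : M → ℝ)
    (Y : Fin F.dim → F.Field) : Prop where
  isOpen : IsOpen U
  smooth_fun : IsSmoothFunOn (E := E) f U
  smooth_field : ∀ j, IsSmoothFieldOn (Y j).toVF U
  eq : ∀ x ∈ U, η x = f x • exteriorPower.ιMulti ℝ F.dim (fun j => Y j x)

/-- Smooth sections of `det TF`. -/
def IsSmoothDet (F : Foliation E M) (η : Π x : M, F.Det x) : Prop :=
  ∀ x₀ : M, ∃ U f Y, x₀ ∈ U ∧ F.IsLocalExpr η U f Y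

/-- Smooth sections of `det T*F`. -/
def IsSmoothDetDual (F : Foliation E M) (α : Π x : M, F.DetDual x) : Prop :=
  ∀ U : Set M, IsOpen U → ∀ Y : Fin F.dim → F.Field, (∀ j, IsSmoothFieldOn (Y j).toVF U) →
    IsSmoothFunOn (E := E) (fun x => α x (fun j => Y j x)) U

/-- Bott's connection of `F` on the normal bundle `TM / TF`: the derivative along a field `X`
tangent to `F` of the section of `TM / TF` represented by `Y` is `[X, Y] mod TF`. -/
noncomputable def bott (F : Foliation E M) (X : F.Field) (Y : Π x : M, TangentSpace 𝓘(ℝ, E) x)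
    (x : M) : TangentSpace 𝓘(ℝ, E) x ⧸ F.tangent x :=
  (F.tangent x).mkQ (VectorField.mlieBracket 𝓘(ℝ, E) X.toVF Y x)

/-- Bott's connection of `F`, as a partial connection along `F` on `TG` for a complementary
foliation `G`, by means of the identification `TM / TF ≃ TG` given by the projection onto `TG`
along `TF`. -/
noncomputable def bottOn (F G : Foliation E M) (h : ∀ x, IsCompl (F.tangent x) (G.tangent x))
    (X : F.Field) (Y : G.Field) : G.Field :=
  fun x => Submodule.quotientEquivOfIsCompl (F.tangent x) (G.tangent x) (h x) (F.bott X Y.toVF x)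

/-- `D` is the extension of the Bott connection of `F` on `TG` (along `TF`) to `det TG`,
determined by the Leibniz rule. -/
def IsBottDet (F G : Foliation E M) (h : ∀ x, IsCompl (F.tangent x) (G.tangent x))
    (D : F.Field → (Π x : M, G.Det x) → Π x : M, G.Det x) : Prop :=
  ∀ (X : F.Field) (η : Π x : M, G.Det x), IsSmoothFieldOn X.toVF Set.univ → G.IsSmoothDet η →
    ∀ U f Y, G.IsLocalExpr η U f Y → ∀ x ∈ U,
      D X η x = lieDer X.toVF f x • exteriorPower.ιMulti ℝ G.dim (fun j => Y j x) +
        f x • ∑ j, exteriorPower.ιMulti ℝ G.dim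
          (Function.update (fun k => Y k x) j (F.bottOn G h X (Y j) x))

/-- `D` is the extension of the Bott connection of `F` on `TG` (along `TF`) to `det T*G`, the dual
of `det TG`, determined by the Leibniz rule. -/
def IsBottDetDual (F G : Foliation E M) (h : ∀ x, IsCompl (F.tangent x) (G.tangent x))
    (D : F.Field → (Π x : M, G.DetDual x) → Π x : M, G.DetDual x) : Prop :=
  ∀ (X : F.Field) (α : Π x : M, G.DetDual x), IsSmoothFieldOn X.toVF Set.univ →
    G.IsSmoothDetDual α → ∀ U : Set M, IsOpen U → ∀ Y : Fin G.dim → G.Field,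
      (∀ j, IsSmoothFieldOn (Y j).toVF U) → ∀ x ∈ U,
      D X α x (fun j => Y j x) = lieDer X.toVF (fun y => α y (fun j => Y j y)) x -
        ∑ j, α x (Function.update (fun k => Y k x) j (F.bottOn G h X (Y j) x))

end Foliation

/-! ### Divergence-free webs -/

/-- A divergence-free `n`-web: `n` foliations in general position, whose codimensions add up to the
dimension of the manifold, and a volume form. -/
structure DivergenceFreeWeb (E : Type*) [NormedAddCommGroup E] [NormedSpace ℝ E]
    (M : Type*) [TopologicalSpace M] [ChartedSpace E M] [IsManifold 𝓘(ℝ, E) ∞ M] (n : ℕ) where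
  fol : Fin n → Foliation E M
  vol : VolumeForm E M
  /-- `codim ⋂ᵢ T_x Fᵢ = ∑ᵢ codim T_x Fᵢ` -/
  general_position : ∀ x : M,
    Module.finrank ℝ (⨅ i, (fol i).tangent x : Submodule ℝ (TangentSpace 𝓘(ℝ, E) x)) +
      ∑ i, (fol i).codim = Module.finrank ℝ E
  sum_codim : ∑ i, (fol i).codim = Module.finrank ℝ E

namespace DivergenceFreeWeb

variable [IsManifold 𝓘(ℝ, E) ∞ M] {n : ℕ}

theorem sum_codim_ne (W : DivergenceFreeWeb E M n) (i : Fin n) :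
    (W.fol i).codim + ∑ j : {j // j ≠ i}, (W.fol j).codim = Module.finrank ℝ E := by
  rw [← W.sum_codim]
  exact (Fintype.sum_eq_add_sum_subtype_ne (fun j => (W.fol j).codim) i).symm

theorem iInf_tangent (W : DivergenceFreeWeb E M n) [FiniteDimensional ℝ E] (x : M) :
    (⨅ i, (W.fol i).tangent x) = ⊥ := by
  have : FiniteDimensional ℝ (TangentSpace 𝓘(ℝ, E) x) := inferInstanceAs (FiniteDimensional ℝ E)
  have h1 := W.general_position x
  have h2 := W.sum_codim
  exact Submodule.finrank_eq_zero.mp (by omega)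

theorem disjoint_compl (W : DivergenceFreeWeb E M n) [FiniteDimensional ℝ E] (i : Fin n) (x : M) :
    Disjoint (⨅ j : {j // j ≠ i}, (W.fol j).tangent x) ((W.fol i).tangent x) := by
  rw [disjoint_iff, eq_bot_iff, ← W.iInf_tangent x]
  refine le_iInf fun j => ?_
  by_cases h : j = i
  · subst h; exact inf_le_right
  · exact inf_le_left.trans (iInf_le (fun j : {j // j ≠ i} => (W.fol j).tangent x) ⟨j, h⟩)

theorem finrank_compl (W : DivergenceFreeWeb E M n) [FiniteDimensional ℝ E] (i : Fin n) (x : M) :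
    Module.finrank ℝ (⨅ j : {j // j ≠ i}, (W.fol j).tangent x :
      Submodule ℝ (TangentSpace 𝓘(ℝ, E) x)) = (W.fol i).codim := by
  have : FiniteDimensional ℝ (TangentSpace 𝓘(ℝ, E) x) := inferInstanceAs (FiniteDimensional ℝ E)
  have hE : Module.finrank ℝ (TangentSpace 𝓘(ℝ, E) x) = Module.finrank ℝ E := rfl
  have h1 := finrank_le_finrank_iInf_add
    (fun j : {j // j ≠ i} => (W.fol j).tangent x) (fun j => (W.fol j).codim) (fun j => by
      rw [(W.fol j).finrank_tangent, (W.fol j).dim_add_codim, hE])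
  have h2 := Submodule.finrank_add_finrank_le_of_disjoint (W.disjoint_compl i x)
  rw [(W.fol i).finrank_tangent x] at h2
  have h3 := (W.fol i).dim_add_codim
  have h4 := W.sum_codim_ne i
  omega

/-- The foliation `Fᵢᶜ` complementary to `Fᵢ`, with tangent distribution `⋂_{j ≠ i} TFⱼ`. -/
noncomputable def compl [FiniteDimensional ℝ E] (W : DivergenceFreeWeb E M n) (i : Fin n) : Foliation E M where
  tangent x := ⨅ j : {j // j ≠ i}, (W.fol j).tangent x
  dim := (W.fol i).codim
  codim := ∑ j : {j // j ≠ i}, (W.fol j).codim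
  dim_add_codim := W.sum_codim_ne i
  finrank_tangent x := W.finrank_compl i x
  smooth x₀ := by
    choose U hU hx₀ ξ hξ hker using fun j : {j // j ≠ i} => (W.fol j).smooth x₀
    have e : (Σ j : {j // j ≠ i}, Fin (W.fol j).codim) ≃
        Fin (∑ j : {j // j ≠ i}, (W.fol j).codim) :=
      Fintype.equivFinOfCardEq (by simp)
    refine ⟨⋂ j, U j, isOpen_iInter_of_finite hU, Set.mem_iInter.mpr hx₀,
      fun k => ξ (e.symm k).1 (e.symm k).2, fun k U' hU' hsub => ?_, fun x hx => ?_⟩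
    · exact hξ _ _ U' hU' (hsub.trans (Set.iInter_subset _ _))
    · rw [Set.mem_iInter] at hx
      rw [e.symm.iInf_comp (g := fun s : (Σ j : {j // j ≠ i}, Fin (W.fol j).codim) =>
        LinearMap.ker (ξ s.1 s.2 x)), iInf_sigma]
      exact iInf_congr fun j => hker j x (hx j)
  involutive U hU X Y hX hY x hx := by
    rw [Submodule.mem_iInf]
    intro j
    exact (W.fol j).involutive U hU
      (fun y => ⟨X y, (Submodule.mem_iInf _).mp (X y).2 j⟩)
      (fun y => ⟨Y y, (Submodule.mem_iInf _).mp (Y y).2 j⟩) hX hY x hx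

theorem isCompl_compl [FiniteDimensional ℝ E] (W : DivergenceFreeWeb E M n) (i : Fin n) (x : M) :
    IsCompl ((W.compl i).tangent x) ((W.fol i).tangent x) := by
  have : FiniteDimensional ℝ (TangentSpace 𝓘(ℝ, E) x) := inferInstanceAs (FiniteDimensional ℝ E)
  refine (Submodule.isCompl_iff_disjoint _ _ ?_).mpr (W.disjoint_compl i x)
  rw [(W.compl i).finrank_tangent, (W.fol i).finrank_tangent]
  have h := (W.fol i).dim_add_codim
  have hE : Module.finrank ℝ (TangentSpace 𝓘(ℝ, E) x) = Module.finrank ℝ E := rfl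
  change _ ≤ (W.fol i).codim + _
  omega

/-- The divergence-free `2`-web `(M, Fᵢᶜ, Fᵢ, Ω)`. -/
noncomputable def twoWeb [FiniteDimensional ℝ E] (W : DivergenceFreeWeb E M n) (i : Fin n) :
    DivergenceFreeWeb E M 2 where
  fol := ![W.compl i, W.fol i]
  vol := W.vol
  general_position x := by
    have h : (⨅ k, ((![W.compl i, W.fol i] : Fin 2 → Foliation E M) k).tangent x) = ⊥ := by
      rw [eq_bot_iff, ← (W.isCompl_compl i x).inf_eq_bot]
      exact le_inf (iInf_le _ 0) (iInf_le _ 1)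
    rw [h, finrank_bot, Fin.sum_univ_two, ← W.sum_codim_ne i]
    change 0 + (∑ j : {j // j ≠ i}, (W.fol j).codim + (W.fol i).codim) = _
    omega
  sum_codim := by
    rw [Fin.sum_univ_two, ← W.sum_codim_ne i]
    exact add_comm _ _

/-! ### Connections -/

/-- `Θ` is a `W_Ω`-connection: a smooth torsionless affine connection for which the foliations
of the web and the volume form are parallel. -/
structure IsWebConnection [FiniteDimensional ℝ E] (W : DivergenceFreeWeb E M n)
    (Θ : CovariantDerivative 𝓘(ℝ, E) E (TangentSpace 𝓘(ℝ, E) : M → Type _)) : Prop where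
  smooth : CovariantDerivative.ContMDiffCovariantDerivative Θ ∞
  torsionless : haveI : CompleteSpace E := FiniteDimensional.complete ℝ E; Θ.torsion = 0
  fol_parallel : ∀ i (U : Set M), IsOpen U → ∀ Y : (W.fol i).Field, IsSmoothFieldOn Y.toVF U →
    ∀ x ∈ U, ∀ v, Θ Y.toVF x v ∈ (W.fol i).tangent x
  vol_parallel : ∀ U : Set M, IsOpen U →
    ∀ Y : Fin (Module.finrank ℝ E) → Π x : M, TangentSpace 𝓘(ℝ, E) x,
    (∀ j, IsSmoothFieldOn (Y j) U) → ∀ x ∈ U, ∀ v : TangentSpace 𝓘(ℝ, E) x,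
      mvfderiv 𝓘(ℝ, E) (fun y => W.vol.toForm y (fun j => Y j y)) x v =
        ∑ j, W.vol.toForm x (Function.update (fun k => Y k x) j (Θ (Y j) x v))

/-- The fibre at `x` of the Whitney sum `⨁ᵢ det TFᵢᶜ`. -/
abbrev DetSum [FiniteDimensional ℝ E] (W : DivergenceFreeWeb E M n) (x : M) : Type _ :=
  Π i, (W.compl i).Det x

/-- A section of `det TFᵢᶜ`, as a section of `⨁ⱼ det TFⱼᶜ`. -/
noncomputable def incl [FiniteDimensional ℝ E] (W : DivergenceFreeWeb E M n) (i : Fin n)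
    (η : Π x : M, (W.compl i).Det x) : Π x : M, W.DetSum x :=
  fun x => Pi.single i (η x)

/-- The action of the affine connection `Θ` on multivector fields induces the operator `N` on
sections of `⨁ᵢ det TFᵢᶜ`: if the `i`-th component of the section `s` is `f · Y₁ ∧ ⋯ ∧ Y_d` on an
open set, then, as a multivector in `TM`, the `i`-th component of `N_X s` is
`(X f) · Y₁ ∧ ⋯ ∧ Y_d + f · ∑ⱼ Y₁ ∧ ⋯ ∧ Θ_X Yⱼ ∧ ⋯ ∧ Y_d` there. -/
def IsInducedBy [FiniteDimensional ℝ E] (W : DivergenceFreeWeb E M n)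
    (Θ : CovariantDerivative 𝓘(ℝ, E) E (TangentSpace 𝓘(ℝ, E) : M → Type _))
    (N : (Π x : M, TangentSpace 𝓘(ℝ, E) x) → (Π x : M, W.DetSum x) → Π x : M, W.DetSum x) :
    Prop :=
  ∀ (X : Π x : M, TangentSpace 𝓘(ℝ, E) x) (s : Π x : M, W.DetSum x),
    IsSmoothFieldOn X Set.univ → (∀ i, (W.compl i).IsSmoothDet (fun x => s x i)) →
    ∀ i U f Y, (W.compl i).IsLocalExpr (fun x => s x i) U f Y → ∀ x ∈ U,
      exteriorPower.map (W.compl i).dim ((W.compl i).tangent x).subtype (N X s x i) =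
        lieDer X f x • exteriorPower.ιMulti ℝ (W.compl i).dim (fun j => (Y j).toVF x) +
        f x • ∑ j, exteriorPower.ιMulti ℝ (W.compl i).dim
          (Function.update (fun k => (Y k).toVF x) j (Θ (Y j).toVF x (X x)))

/-- `N` is the natural connection of the divergence-free web on `⨁ᵢ det TFᵢᶜ`: the connection
induced by the action of a `W_Ω`-connection, whichever `W_Ω`-connection is chosen. -/
def IsNaturalConnection [FiniteDimensional ℝ E] (W : DivergenceFreeWeb E M n)
    (N : (Π x : M, TangentSpace 𝓘(ℝ, E) x) → (Π x : M, W.DetSum x) → Π x : M, W.DetSum x) :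
    Prop :=
  (∃ Θ, W.IsWebConnection Θ) ∧ ∀ Θ, W.IsWebConnection Θ → W.IsInducedBy Θ N

/-! ### Tabachnikov's connection -/

theorem isCompl [FiniteDimensional ℝ E] (W : DivergenceFreeWeb E M 2) (x : M) :
    IsCompl ((W.fol 0).tangent x) ((W.fol 1).tangent x) := by
  have : FiniteDimensional ℝ (TangentSpace 𝓘(ℝ, E) x) := inferInstanceAs (FiniteDimensional ℝ E)
  have hE : Module.finrank ℝ (TangentSpace 𝓘(ℝ, E) x) = Module.finrank ℝ E := rfl
  have hd : Disjoint ((W.fol 0).tangent x) ((W.fol 1).tangent x) := by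
    rw [disjoint_iff, eq_bot_iff, ← W.iInf_tangent x]
    refine le_iInf fun j => ?_
    fin_cases j
    · exact inf_le_left
    · exact inf_le_right
  refine (Submodule.isCompl_iff_disjoint _ _ ?_).mpr hd
  rw [(W.fol 0).finrank_tangent, (W.fol 1).finrank_tangent]
  have h0 := (W.fol 0).dim_add_codim
  have h1 := (W.fol 1).dim_add_codim
  have h2 := W.sum_codim
  rw [Fin.sum_univ_two] at h2
  omega

/-- The component `X_F` of a vector field `X = X_F + X_G` on a `2`-web `(M, F, G, Ω)`. -/
noncomputable def compF [FiniteDimensional ℝ E] (W : DivergenceFreeWeb E M 2)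
    (X : Π x : M, TangentSpace 𝓘(ℝ, E) x) : (W.fol 0).Field :=
  fun x => Submodule.projectionOnto _ _ (W.isCompl x) (X x)

/-- The component `X_G` of a vector field `X = X_F + X_G` on a `2`-web `(M, F, G, Ω)`. -/
noncomputable def compG [FiniteDimensional ℝ E] (W : DivergenceFreeWeb E M 2)
    (X : Π x : M, TangentSpace 𝓘(ℝ, E) x) : (W.fol 1).Field :=
  fun x => Submodule.projectionOnto _ _ (W.isCompl x).symm (X x)

/-- The isomorphism `μ : det TF → det T*G`, `η ↦ η ⌟ Ω`, of a `2`-web `(M, F, G, Ω)`. -/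
noncomputable def mu [FiniteDimensional ℝ E] (W : DivergenceFreeWeb E M 2) (x : M) :
    (W.fol 0).Det x ≃ₗ[ℝ] (W.fol 1).DetDual x :=
  LinearEquiv.ofBijective
    (contraction (W.vol.toForm x) ((W.fol 0).tangent x) ((W.fol 1).tangent x)
      (W.fol 0).dim (W.fol 1).dim)
    (haveI : FiniteDimensional ℝ (TangentSpace 𝓘(ℝ, E) x) :=
      inferInstanceAs (FiniteDimensional ℝ E)
    contraction_bijective _ (W.vol.ne_zero x) _ _ (W.isCompl x) rfl
      ((W.fol 0).finrank_tangent x) ((W.fol 1).finrank_tangent x))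

/-- `D` is Tabachnikov's connection on `det TF` of the divergence-free `2`-web `(M, F, G, Ω)`:
`D_X η = μ⁻¹ (D^F_{X_F} (μ η)) + D^G_{X_G} η`, where `D^F` and `D^G` are the extensions of the
Bott connections of `F` and `G` to `det T*G` and to `det TF`. -/
def IsTabachnikovConnection [FiniteDimensional ℝ E] (W : DivergenceFreeWeb E M 2)
    (D : (Π x : M, TangentSpace 𝓘(ℝ, E) x) → (Π x : M, (W.fol 0).Det x) →
      Π x : M, (W.fol 0).Det x) : Prop :=
  ∃ DF DG, (W.fol 0).IsBottDetDual (W.fol 1) W.isCompl DF ∧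
    (W.fol 1).IsBottDet (W.fol 0) (fun x => (W.isCompl x).symm) DG ∧
    ∀ (X : Π x : M, TangentSpace 𝓘(ℝ, E) x) (η : Π x : M, (W.fol 0).Det x),
      IsSmoothFieldOn X Set.univ → (W.fol 0).IsSmoothDet η → ∀ x,
        D X η x = (W.mu x).symm (DF (W.compF X) (fun y => W.mu y (η y)) x) + DG (W.compG X) η x

end DivergenceFreeWeb

end Manifold

/-! ### Calculus with smooth fields -/

section Calculus

open Bundle VectorField

variable {E : Type*} [NormedAddCommGroup E] [NormedSpace ℝ E]
  {M : Type*} [TopologicalSpace M] [ChartedSpace E M]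

/-! Take first a `2`-web (F, G, Ω) with a torsionless connection Θ preserving F, G and Ω. For X in
TF and Y in TG, [X, Y] = Θ_X Y - Θ_Y X, and the last term lies in TF, so modulo TF Bott's derivative
of Y is Θ_X Y (`Foliation.bottOn_eq`). The same holds with F and G exchanged. Hence the Leibniz
extensions of the two Bott connections are the actions of Θ on det T*G along F and on det TF along
G. As Ω is parallel, μ commutes with Θ (`mu_leibniz`), so μ⁻¹ D^F μ is the action of Θ on det TF
along F. Adding the derivatives along X_F and X_G gives Θ_X η: Θ induces Tabachnikov's connection
(`isTabachnikovConnection_covDet`). The latter is determined by the web alone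
(`IsTabachnikovConnection.unique`), so the induced connection does not depend on Θ.

An intersection of parallel distributions is parallel, so a connection for the `n`-web is also one
for each `2`-web (Fᵢᶜ, Fᵢ, Ω) (`IsWebConnection.twoWeb`), and the comparison is made one summand at
a time.

It remains to find some Θ. The forms defining all the foliations make up a local coframe
(`exists_adaptedFrame`), and Christoffel symbols are written in the dual frame. Parallel foliations
mean that the symbols do not mix blocks. Zero torsion then forces the symbols whose two lower
indices lie in different blocks; within one block, half of the bracket coefficient plus any
symmetric term will do. A symmetric term of prescribed trace makes Ω parallel (`webSymbol_sub`,
`sum_webSymbol`). All the conditions are affine in Θ, so a partition of unity glues the local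
solutions (`exists_isWebConnection`). -/

instance TangentSpace.finiteDimensional_model [FiniteDimensional ℝ E] (x : M) :
    FiniteDimensional ℝ (TangentSpace 𝓘(ℝ, E) x) :=
  inferInstanceAs (FiniteDimensional ℝ E)

instance TangentSpace.t2Space_model (x : M) : T2Space (TangentSpace 𝓘(ℝ, E) x) :=
  inferInstanceAs (T2Space E)

section Fun

variable {f g : M → ℝ} {U V : Set M} {x : M}

theorem IsSmoothFunOn.mono (hf : IsSmoothFunOn (E := E) f U) (h : V ⊆ U) :
    IsSmoothFunOn (E := E) f V :=
  ContMDiffOn.mono hf h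

theorem IsSmoothFunOn.congr (hf : IsSmoothFunOn (E := E) f U) (h : ∀ y ∈ U, g y = f y) :
    IsSmoothFunOn (E := E) g U :=
  ContMDiffOn.congr hf h

theorem IsSmoothFunOn.mdiffAt (hf : IsSmoothFunOn (E := E) f U) (hU : IsOpen U) (hx : x ∈ U) :
    MDifferentiableAt 𝓘(ℝ, E) 𝓘(ℝ, ℝ) f x :=
  (ContMDiffOn.contMDiffAt hf (hU.mem_nhds hx)).mdifferentiableAt (by simp)

theorem isSmoothFunOn_const (c : ℝ) : IsSmoothFunOn (E := E) (fun _ : M => c) U :=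
  contMDiffOn_const

theorem IsSmoothFunOn.add (hf : IsSmoothFunOn (E := E) f U) (hg : IsSmoothFunOn (E := E) g U) :
    IsSmoothFunOn (E := E) (fun y => f y + g y) U :=
  ContMDiffOn.add hf hg

theorem IsSmoothFunOn.sub (hf : IsSmoothFunOn (E := E) f U) (hg : IsSmoothFunOn (E := E) g U) :
    IsSmoothFunOn (E := E) (fun y => f y - g y) U :=
  ContMDiffOn.sub hf hg

theorem IsSmoothFunOn.mul (hf : IsSmoothFunOn (E := E) f U) (hg : IsSmoothFunOn (E := E) g U) :
    IsSmoothFunOn (E := E) (fun y => f y * g y) U :=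
  ContMDiffOn.mul hf hg

theorem IsSmoothFunOn.inv (hf : IsSmoothFunOn (E := E) f U) (h : ∀ y ∈ U, f y ≠ 0) :
    IsSmoothFunOn (E := E) (fun y => (f y)⁻¹) U := fun y hy =>
  (contDiffAt_inv ℝ (h y hy)).contMDiffAt.comp_contMDiffWithinAt y (hf y hy)

theorem IsSmoothFunOn.div (hf : IsSmoothFunOn (E := E) f U) (hg : IsSmoothFunOn (E := E) g U)
    (h : ∀ y ∈ U, g y ≠ 0) : IsSmoothFunOn (E := E) (fun y => f y / g y) U := by
  simpa only [div_eq_mul_inv] using hf.mul (hg.inv h)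

theorem isSmoothFunOn_sum {ι : Type*} {s : Finset ι} {f : ι → M → ℝ}
    (hf : ∀ i ∈ s, IsSmoothFunOn (E := E) (f i) U) :
    IsSmoothFunOn (E := E) (fun y => ∑ i ∈ s, f i y) U :=
  contMDiffOn_finsetSum hf

theorem isSmoothFunOn_prod {ι : Type*} {s : Finset ι} {f : ι → M → ℝ}
    (hf : ∀ i ∈ s, IsSmoothFunOn (E := E) (f i) U) :
    IsSmoothFunOn (E := E) (fun y => ∏ i ∈ s, f i y) U :=
  contMDiffOn_finsetProd hf

theorem isSmoothFunOn_det {ι : Type*} [Fintype ι] [DecidableEq ι] {A : M → Matrix ι ι ℝ}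
    (hA : ∀ i j, IsSmoothFunOn (E := E) (fun y => A y i j) U) :
    IsSmoothFunOn (E := E) (fun y => (A y).det) U := by
  simp only [Matrix.det_apply']
  exact isSmoothFunOn_sum fun σ _ =>
    (isSmoothFunOn_const _).mul (isSmoothFunOn_prod fun i _ => hA _ _)

/-- Cramer's rule: an entry of the inverse is a quotient of determinants, the numerator having one
row replaced by a constant one. -/
theorem isSmoothFunOn_matrix_inv {ι : Type*} [Fintype ι] [DecidableEq ι] {A : M → Matrix ι ι ℝ}
    (hA : ∀ i j, IsSmoothFunOn (E := E) (fun y => A y i j) U) (hdet : ∀ y ∈ U, (A y).det ≠ 0)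
    (i j : ι) : IsSmoothFunOn (E := E) (fun y => (A y)⁻¹ i j) U := by
  simp only [Matrix.inv_def, Ring.inverse_eq_inv', Matrix.smul_apply, smul_eq_mul,
    Matrix.adjugate_apply]
  refine ((isSmoothFunOn_det hA).inv hdet).mul (isSmoothFunOn_det fun k l => ?_)
  by_cases h : k = j
  · subst h
    simpa using isSmoothFunOn_const _
  · simpa [Matrix.updateRow_ne h] using hA k l

theorem mvfderiv_finsetSum {ι : Type*} {s : Finset ι} {f : ι → M → ℝ}
    (hf : ∀ i ∈ s, MDifferentiableAt 𝓘(ℝ, E) 𝓘(ℝ, ℝ) (f i) x) :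
    MDifferentiableAt 𝓘(ℝ, E) 𝓘(ℝ, ℝ) (fun y => ∑ i ∈ s, f i y) x ∧
      mvfderiv 𝓘(ℝ, E) (fun y => ∑ i ∈ s, f i y) x = ∑ i ∈ s, mvfderiv 𝓘(ℝ, E) (f i) x := by
  classical
  induction s using Finset.induction_on with
  | empty => exact ⟨by simpa using mdifferentiableAt_const, by simp [mvfderiv_const]⟩
  | insert a s ha ih =>
    obtain ⟨h1, h2⟩ := ih fun i hi => hf i (Finset.mem_insert_of_mem hi)
    have h3 := hf a (Finset.mem_insert_self a s)
    simp only [Finset.sum_insert ha]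
    refine ⟨h3.add h1, ?_⟩
    rw [← h2]
    exact mvfderiv_add h3 h1

theorem Filter.EventuallyEq.mvfderiv_eq (h : f =ᶠ[nhds x] g) :
    mvfderiv 𝓘(ℝ, E) f x = mvfderiv 𝓘(ℝ, E) g x := by
  ext v
  simp only [mvfderiv, ContinuousLinearMap.comp_apply]
  rw [h.mfderiv_eq, h.eq_of_nhds]

end Fun

theorem mlieBracket_congr_of_eqOn {X Y X' Y' : Π x : M, TangentSpace 𝓘(ℝ, E) x} {U : Set M}
    {x : M} (hU : IsOpen U) (hX : ∀ y ∈ U, X y = X' y) (hY : ∀ y ∈ U, Y y = Y' y) (hx : x ∈ U) :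
    mlieBracket 𝓘(ℝ, E) X Y x = mlieBracket 𝓘(ℝ, E) X' Y' x :=
  Filter.EventuallyEq.mlieBracket_vectorField_eq
    (Filter.eventually_of_mem (hU.mem_nhds hx) hX) (Filter.eventually_of_mem (hU.mem_nhds hx) hY)

theorem mvfderiv_congr_of_eqOn {f g : M → ℝ} {U : Set M} {x : M} (hU : IsOpen U)
    (h : ∀ y ∈ U, f y = g y) (hx : x ∈ U) :
    mvfderiv 𝓘(ℝ, E) f x = mvfderiv 𝓘(ℝ, E) g x :=
  Filter.EventuallyEq.mvfderiv_eq (Filter.eventually_of_mem (hU.mem_nhds hx) h)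

variable [IsManifold 𝓘(ℝ, E) ∞ M] {X Y : Π x : M, TangentSpace 𝓘(ℝ, E) x} {f g : M → ℝ}
  {U V : Set M} {x : M}

namespace IsSmoothFieldOn

theorem mono (hX : IsSmoothFieldOn X U) (h : V ⊆ U) : IsSmoothFieldOn X V :=
  ContMDiffOn.mono hX h

theorem congr (hX : IsSmoothFieldOn X U) (h : ∀ y ∈ U, Y y = X y) : IsSmoothFieldOn Y U :=
  ContMDiffOn.congr hX fun y hy => by rw [h y hy]

theorem contMDiffAt (hX : IsSmoothFieldOn X U) (hU : IsOpen U) (hx : x ∈ U) :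
    ContMDiffAt 𝓘(ℝ, E) (𝓘(ℝ, E).prod 𝓘(ℝ, E)) ∞
      (fun y => (⟨y, X y⟩ : TangentBundle 𝓘(ℝ, E) M)) x :=
  ContMDiffOn.contMDiffAt hX (hU.mem_nhds hx)

theorem mdiffAt (hX : IsSmoothFieldOn X U) (hU : IsOpen U) (hx : x ∈ U) :
    MDifferentiableAt 𝓘(ℝ, E) (𝓘(ℝ, E).prod 𝓘(ℝ, E))
      (fun y => (⟨y, X y⟩ : TangentBundle 𝓘(ℝ, E) M)) x :=
  (hX.contMDiffAt hU hx).mdifferentiableAt (by simp)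

theorem zero : IsSmoothFieldOn (fun x : M => (0 : TangentSpace 𝓘(ℝ, E) x)) U :=
  (contMDiff_zeroSection ℝ (TangentSpace 𝓘(ℝ, E) : M → Type _)).contMDiffOn.of_le le_top

theorem add (hX : IsSmoothFieldOn X U) (hY : IsSmoothFieldOn Y U) :
    IsSmoothFieldOn (fun y => X y + Y y) U :=
  ContMDiffOn.add_section hX hY

theorem smul (hf : IsSmoothFunOn (E := E) f U) (hX : IsSmoothFieldOn X U) :
    IsSmoothFieldOn (fun y => f y • X y) U :=
  ContMDiffOn.smul_section hf hX

theorem sum {ι : Type*} {s : Finset ι} {X : ι → Π x : M, TangentSpace 𝓘(ℝ, E) x}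
    (hX : ∀ i ∈ s, IsSmoothFieldOn (X i) U) : IsSmoothFieldOn (fun y => ∑ i ∈ s, X i y) U :=
  ContMDiffOn.sum_section hX

variable [FiniteDimensional ℝ E]

theorem mlieBracket (hX : IsSmoothFieldOn X U) (hY : IsSmoothFieldOn Y U) (hU : IsOpen U) :
    IsSmoothFieldOn (mlieBracket 𝓘(ℝ, E) X Y) U := fun x hx => by
  have : CompleteSpace E := FiniteDimensional.complete ℝ E
  -- Since ∞ + 1 = ∞, the derivative taken by the bracket costs no regularity.
  have : IsManifold 𝓘(ℝ, E) ((⊤ : ℕ∞) + 1 : ℕ∞ω) M :=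
    inferInstanceAs (IsManifold 𝓘(ℝ, E) ∞ M)
  have : IsManifold 𝓘(ℝ, E) (minSmoothness ℝ 2) M := by
    rw [minSmoothness_of_isRCLikeNormedField]; infer_instance
  exact (ContMDiffAt.mlieBracket_vectorField (m := ⊤) (n := ⊤) (hX.contMDiffAt hU hx)
    (hY.contMDiffAt hU hx) (by simp)).contMDiffWithinAt

end IsSmoothFieldOn

/-- X f is the fibre component of the tangent map of f composed with the section X. -/
theorem IsSmoothFunOn.lieDer (hf : IsSmoothFunOn (E := E) f U) (hX : IsSmoothFieldOn X U)
    (hU : IsOpen U) : IsSmoothFunOn (E := E) (lieDer X f) U := by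
  have h1 : ContMDiffOn 𝓘(ℝ, E).tangent 𝓘(ℝ, ℝ).tangent ∞ (tangentMapWithin 𝓘(ℝ, E) 𝓘(ℝ, ℝ) f U)
      (TotalSpace.proj ⁻¹' U) :=
    ContMDiffOn.contMDiffOn_tangentMapWithin hf (by simp) hU.uniqueMDiffOn
  have h2 := h1.comp hX (fun y hy => hy)
  have h3 := (contMDiff_snd_tangentBundle_modelSpace (n := ∞) ℝ 𝓘(ℝ, ℝ)).comp_contMDiffOn h2
  refine ContMDiffOn.congr h3 fun y hy => ?_
  change mfderiv 𝓘(ℝ, E) 𝓘(ℝ, ℝ) f y (X y) = mfderivWithin 𝓘(ℝ, E) 𝓘(ℝ, ℝ) f U y (X y)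
  rw [mfderivWithin_of_isOpen hU hy]

variable [FiniteDimensional ℝ E]

/-- In finite dimension a linear map is the tuple of its values on a basis, and in the
trivialization the local frame becomes the constant basis `b`. This reduces smoothness of Θ Y, a
section of a Hom bundle, to smoothness of vector fields. -/
theorem contMDiffAt_hom_of_apply_localFrame {ι : Type*} [Fintype ι] (b : Module.Basis ι ℝ E)
    {A : Π x : M, TangentSpace 𝓘(ℝ, E) x →L[ℝ] TangentSpace 𝓘(ℝ, E) x} {x₀ : M}
    (hA : ∀ l, ContMDiffAt 𝓘(ℝ, E) (𝓘(ℝ, E).prod 𝓘(ℝ, E)) ∞ (fun x => (⟨x, A x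
      ((trivializationAt E (TangentSpace 𝓘(ℝ, E)) x₀).localFrame b l x)⟩ :
        TangentBundle 𝓘(ℝ, E) M)) x₀) :
    ContMDiffAt 𝓘(ℝ, E) (𝓘(ℝ, E).prod 𝓘(ℝ, E →L[ℝ] E)) ∞
      (fun x => (⟨x, A x⟩ : TotalSpace (E →L[ℝ] E)
        fun x : M => TangentSpace 𝓘(ℝ, E) x →L[ℝ] TangentSpace 𝓘(ℝ, E) x)) x₀ := by
  rw [contMDiffAt_hom_bundle]
  refine ⟨contMDiffAt_id, ?_⟩
  let e : (E →L[ℝ] E) ≃L[ℝ] (ι → E) :=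
    (LinearMap.toContinuousLinearMap.symm.trans (b.constr ℝ).symm).toContinuousLinearEquiv
  have he : ∀ (B : E →L[ℝ] E) l, e B l = B (b l) := fun B l => rfl
  suffices h : ContMDiffAt 𝓘(ℝ, E) 𝓘(ℝ, ι → E) ∞ (fun x => e
      (ContinuousLinearMap.inCoordinates E (TangentSpace 𝓘(ℝ, E)) E (TangentSpace 𝓘(ℝ, E))
        x₀ x x₀ x (A x))) x₀ by
    have h2 := (e.symm.contDiff (n := ∞)).contMDiff.contMDiffAt.comp x₀ h
    simpa [Function.comp_def] using h2
  rw [contMDiffAt_pi_space]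
  intro l
  have h := hA l
  rw [contMDiffAt_section] at h
  refine h.congr_of_eventuallyEq ?_
  have hx₀ := mem_baseSet_trivializationAt E (TangentSpace 𝓘(ℝ, E)) x₀
  filter_upwards [(trivializationAt E (TangentSpace 𝓘(ℝ, E)) x₀).open_baseSet.mem_nhds hx₀]
    with x hx
  rw [he, ContinuousLinearMap.inCoordinates_eq hx hx,
    Trivialization.localFrame_apply_of_mem_baseSet _ _ hx]
  simp [Trivialization.basisAt]

end Calculus

/-! ### Frames adapted to a web -/

section AdaptedFrame

open Bundle

variable {E : Type*} [NormedAddCommGroup E] [NormedSpace ℝ E]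
  {M : Type*} [TopologicalSpace M] [ChartedSpace E M] [IsManifold 𝓘(ℝ, E) ∞ M]

theorem Foliation.mlieBracket_mem (F : Foliation E M) {U : Set M} (hU : IsOpen U)
    {X Y : Π x : M, TangentSpace 𝓘(ℝ, E) x} (hX : IsSmoothFieldOn X U) (hY : IsSmoothFieldOn Y U)
    (hXF : ∀ x ∈ U, X x ∈ F.tangent x) (hYF : ∀ x ∈ U, Y x ∈ F.tangent x) {x : M} (hx : x ∈ U) :
    VectorField.mlieBracket 𝓘(ℝ, E) X Y x ∈ F.tangent x := by
  classical
  -- `involutive` asks for fields tangent to F at every point. Extension by zero outside U, however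
  -- irregular, is harmless because the bracket is local.
  let cut (Z : Π x : M, TangentSpace 𝓘(ℝ, E) x) (hZ : ∀ x ∈ U, Z x ∈ F.tangent x) : F.Field :=
    fun x => if h : x ∈ U then ⟨Z x, hZ x h⟩ else 0
  have hcut : ∀ Z hZ, ∀ y ∈ U, (cut Z hZ y : TangentSpace 𝓘(ℝ, E) y) = Z y := fun Z hZ y hy => by
    simp [cut, hy]
  have := F.involutive U hU (cut X hXF) (cut Y hYF) (hX.congr (hcut X hXF)) (hY.congr (hcut Y hYF))
    x hx
  rwa [mlieBracket_congr_of_eqOn hU (hcut X hXF) (hcut Y hYF) hx] at this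

variable {n : ℕ}

namespace DivergenceFreeWeb

/-- The index set of the frames adapted to a web: a block of `codim Fᵢ` indices for each `i`. -/
abbrev Index (W : DivergenceFreeWeb E M n) : Type := Σ i : Fin n, Fin (W.fol i).codim

theorem card_index (W : DivergenceFreeWeb E M n) :
    Fintype.card W.Index = Module.finrank ℝ E := by
  simpa using W.sum_codim

/-- A smooth frame on the open set `U`, with its dual coframe, such that each `TFᵢ` is the common
kernel of the forms of the `i`-th block. -/
structure AdaptedFrame (W : DivergenceFreeWeb E M n) (U : Set M) where
  /-- the frame -/
  e : W.Index → Π x : M, TangentSpace 𝓘(ℝ, E) x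
  /-- the dual coframe -/
  ξ : W.Index → Π x : M, TangentSpace 𝓘(ℝ, E) x →L[ℝ] ℝ
  isOpen : IsOpen U
  smooth : ∀ a, IsSmoothFieldOn (e a) U
  smooth_coframe : ∀ a,
    IsSmoothOneFormOn (fun x => (ξ a x : Module.Dual ℝ (TangentSpace 𝓘(ℝ, E) x))) U
  dual : ∀ x ∈ U, ∀ a b, ξ a x (e b x) = if a = b then 1 else 0
  expand : ∀ x ∈ U, ∀ v, ∑ a, ξ a x v • e a x = v
  mem_iff : ∀ x ∈ U, ∀ i v, v ∈ (W.fol i).tangent x ↔ ∀ a, a.1 = i → ξ a x v = 0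

/-- The local equations of all the foliations are as many forms as the dimension, and their common
kernel ⋂ᵢ TFᵢ is zero. So their matrix on a frame of a trivialization is invertible, and the columns
of the inverse give the dual frame. -/
theorem exists_adaptedFrame [FiniteDimensional ℝ E] (W : DivergenceFreeWeb E M n) (x₀ : M) :
    ∃ U, x₀ ∈ U ∧ Nonempty (W.AdaptedFrame U) := by
  choose U hU hx₀ ξ hξ hker using fun i => (W.fol i).smooth x₀
  let t := trivializationAt E (TangentSpace 𝓘(ℝ, E) : M → Type _) x₀
  let b : Module.Basis W.Index ℝ E := (Module.finBasis ℝ E).reindex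
    (Fintype.equivOfCardEq (by simp [W.sum_codim]))
  let s := t.localFrame b
  let V : Set M := (⋂ i, U i) ∩ t.baseSet
  have hVo : IsOpen V := (isOpen_iInter_of_finite hU).inter t.open_baseSet
  have hVU : ∀ i, V ⊆ U i := fun i x hx => Set.mem_iInter.mp hx.1 i
  have hs : ∀ l, IsSmoothFieldOn (s l) V := fun l =>
    (t.contMDiffOn_localFrame_baseSet (I := 𝓘(ℝ, E)) ∞ b l).mono Set.inter_subset_right
  let A : M → Matrix W.Index W.Index ℝ := fun x => Matrix.of fun a l => ξ a.1 a.2 x (s l x)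
  have hA : ∀ a l, IsSmoothFunOn (E := E) (fun x => A x a l) V := fun a l =>
    hξ a.1 a.2 V hVo (hVU a.1) (s l) (hs l)
  have hmem : ∀ x ∈ V, ∀ i v, v ∈ (W.fol i).tangent x ↔ ∀ k, ξ i k x v = 0 := fun x hx i v => by
    rw [hker i x (hVU i hx)]; simp
  have hinj : ∀ x ∈ V, ∀ v, (∀ a : W.Index, ξ a.1 a.2 x v = 0) → v = 0 := fun x hx v hv => by
    have : v ∈ ⨅ i, (W.fol i).tangent x :=
      (Submodule.mem_iInf _).mpr fun i => (hmem x hx i v).mpr fun k => hv ⟨i, k⟩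
    rwa [W.iInf_tangent x] at this
  have hdet : ∀ x ∈ V, (A x).det ≠ 0 := by
    intro x hx h0
    obtain ⟨v, hv, hAv⟩ := Matrix.exists_mulVec_eq_zero_iff.mpr h0
    apply hv
    -- A null vector of the matrix would be a combination of the frame annihilated by every form.
    have hz : ∑ l, v l • s l x = 0 := hinj x hx _ fun a => by
      have := congrFun hAv a
      simpa [Matrix.mulVec, dotProduct, A, mul_comm] using this
    have hli := (t.basisAt b hx.2).linearIndependent
    rw [Fintype.linearIndependent_iff] at hli
    funext l
    refine hli v ?_ l
    simpa [s, Trivialization.localFrame_apply_of_mem_baseSet _ _ hx.2] using hz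
  let e : W.Index → Π x : M, TangentSpace 𝓘(ℝ, E) x := fun c x => ∑ l, (A x)⁻¹ l c • s l x
  have hdual : ∀ x ∈ V, ∀ a c : W.Index, ξ a.1 a.2 x (e c x) = if a = c then 1 else 0 := by
    intro x hx a c
    have h := congrFun (congrFun (Matrix.mul_nonsing_inv (A x) (hdet x hx).isUnit) a) c
    rw [Matrix.one_apply, Matrix.mul_apply] at h
    rw [← h, show e c x = ∑ l, (A x)⁻¹ l c • s l x from rfl, map_sum]
    refine Finset.sum_congr rfl fun l _ => ?_
    rw [map_smul, smul_eq_mul, mul_comm]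
    rfl
  refine ⟨V, ⟨Set.mem_iInter.mpr hx₀, mem_baseSet_trivializationAt _ _ _⟩, ⟨{
    e := e
    ξ := fun a x => LinearMap.toContinuousLinearMap (ξ a.1 a.2 x)
    isOpen := hVo
    smooth := fun c => IsSmoothFieldOn.sum fun l _ =>
      IsSmoothFieldOn.smul (isSmoothFunOn_matrix_inv hA hdet l c) (hs l)
    smooth_coframe := fun a U' hU' hsub => hξ a.1 a.2 U' hU' (hsub.trans (hVU _))
    dual := hdual
    expand := fun x hx v => ?_
    mem_iff := fun x hx i v => ?_ }⟩⟩
  · rw [← sub_eq_zero]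
    refine hinj x hx _ fun a => ?_
    rw [map_sub, map_sum]
    simp only [map_smul, hdual x hx, LinearMap.coe_toContinuousLinearMap', smul_eq_mul, mul_ite,
      mul_one, mul_zero, Finset.sum_ite_eq, Finset.mem_univ, if_true, sub_self]
  · rw [hmem x hx]
    constructor
    · rintro h ⟨j, k⟩ rfl
      exact h k
    · exact fun h k => h ⟨i, k⟩ rfl

namespace AdaptedFrame

variable {W : DivergenceFreeWeb E M n} {U : Set M} (φ : W.AdaptedFrame U)
  {X Y : Π x : M, TangentSpace 𝓘(ℝ, E) x} {x : M}

theorem smooth_coeff {V : Set M} (hV : IsOpen V) (hVU : V ⊆ U) (hX : IsSmoothFieldOn X V)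
    (a : W.Index) : IsSmoothFunOn (E := E) (fun x => φ.ξ a x (X x)) V :=
  φ.smooth_coframe a V hV hVU X hX

/-- The axioms of a covariant derivative concern fields differentiable at a single point, whereas
the coframe is only tested on smooth fields. Expanding X in a smooth local frame bridges the gap. -/
theorem mdiffAt_coeff [FiniteDimensional ℝ E] (hx : x ∈ U)
    (hX : MDifferentiableAt 𝓘(ℝ, E) (𝓘(ℝ, E).prod 𝓘(ℝ, E))
      (fun y => (⟨y, X y⟩ : TangentBundle 𝓘(ℝ, E) M)) x) (a : W.Index) :
    MDifferentiableAt 𝓘(ℝ, E) 𝓘(ℝ, ℝ) (fun y => φ.ξ a y (X y)) x := by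
  let t := trivializationAt E (TangentSpace 𝓘(ℝ, E) : M → Type _) x
  have hxt : x ∈ t.baseSet := mem_baseSet_trivializationAt _ _ _
  let b : Module.Basis (Fin (Module.finrank ℝ E)) ℝ E := Module.finBasis ℝ E
  have hV : IsOpen (U ∩ t.baseSet) := φ.isOpen.inter t.open_baseSet
  have h1 : ∀ l, MDifferentiableAt 𝓘(ℝ, E) 𝓘(ℝ, ℝ)
      (fun y => t.localFrameCoeff 𝓘(ℝ, E) b l y (X y) * φ.ξ a y (t.localFrame b l y)) x :=
    fun l => MDifferentiableAt.mul (mdifferentiableAt_localFrameCoeff b hxt hX l)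
      ((φ.smooth_coeff hV Set.inter_subset_left
        ((t.contMDiffOn_localFrame_baseSet (I := 𝓘(ℝ, E)) ∞ b l).mono
          Set.inter_subset_right) a).mdiffAt hV ⟨hx, hxt⟩)
  refine ((mvfderiv_finsetSum fun l (_ : l ∈ Finset.univ) => h1 l).1).congr_of_eventuallyEq ?_
  filter_upwards [t.open_baseSet.mem_nhds hxt] with y hy
  conv_lhs => rw [t.eq_sum_localFrameCoeff_smul (b := b) (I := 𝓘(ℝ, E)) hy (s := X)]
  simp

theorem e_mem {a : W.Index} {i : Fin n} (h : a.1 ≠ i) (hx : x ∈ U) :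
    φ.e a x ∈ (W.fol i).tangent x := by
  rw [φ.mem_iff x hx]
  rintro b rfl
  rw [φ.dual x hx, if_neg]
  rintro rfl
  exact h rfl

/-- The structure functions of the frame. -/
noncomputable def bracketCoeff (a b c : W.Index) (x : M) : ℝ :=
  φ.ξ c x (VectorField.mlieBracket 𝓘(ℝ, E) (φ.e a) (φ.e b) x)

theorem bracketCoeff_swap (a b c : W.Index) (x : M) :
    φ.bracketCoeff a b c x = -φ.bracketCoeff b a c x := by
  rw [bracketCoeff, VectorField.mlieBracket_swap_apply, map_neg, bracketCoeff]

theorem smooth_bracketCoeff [FiniteDimensional ℝ E] (a b c : W.Index) :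
    IsSmoothFunOn (E := E) (φ.bracketCoeff a b c) U :=
  φ.smooth_coeff φ.isOpen subset_rfl ((φ.smooth a).mlieBracket (φ.smooth b) φ.isOpen) c

/-- Both frame fields are tangent to the foliation of the block of c, which is involutive, and the
form ξ_c vanishes on it. -/
theorem bracketCoeff_eq_zero {a b c : W.Index} (ha : c.1 ≠ a.1) (hb : c.1 ≠ b.1) (hx : x ∈ U) :
    φ.bracketCoeff a b c x = 0 :=
  (φ.mem_iff x hx c.1 _).mp ((W.fol c.1).mlieBracket_mem φ.isOpen (φ.smooth a) (φ.smooth b)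
    (fun _ hy => φ.e_mem ha.symm hy) (fun _ hy => φ.e_mem hb.symm hy) hx) c rfl

end AdaptedFrame

end DivergenceFreeWeb

end AdaptedFrame

/-! ### Local connections -/

section LocalConnection

open Bundle

/-- By Cramer's rule the j-th summand is the j-th diagonal entry of adj(A) G A, and tr(adj(A) G A) =
tr(G A adj(A)) = tr(G) det(A). Invertibility of A is not needed. -/
theorem Matrix.sum_det_updateCol_mulVec {ι : Type*} [Fintype ι] [DecidableEq ι]
    (G A : Matrix ι ι ℝ) :
    ∑ j, (A.updateCol j (G.mulVec fun i => A i j)).det = G.trace * A.det := by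
  have h : ∀ j, (A.updateCol j (G.mulVec fun i => A i j)).det = (A.adjugate * (G * A)) j j := by
    intro j
    rw [← Matrix.cramer_apply, Matrix.cramer_eq_adjugate_mulVec, Matrix.mul_apply]
    rfl
  calc ∑ j, (A.updateCol j (G.mulVec fun i => A i j)).det
      = (A.adjugate * (G * A)).trace := Finset.sum_congr rfl fun j _ => h j
    _ = G.trace * A.det := by
        rw [Matrix.trace_mul_comm, Matrix.mul_assoc, Matrix.mul_adjugate, Matrix.mul_smul,
          Matrix.mul_one, Matrix.trace_smul, smul_eq_mul, mul_comm]

variable {E : Type*} [NormedAddCommGroup E] [NormedSpace ℝ E]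
  {M : Type*} [TopologicalSpace M] [ChartedSpace E M]

theorem mvfderiv_finsetProd {ι : Type*} [DecidableEq ι] {s : Finset ι} {f : ι → M → ℝ} {x : M}
    (hf : ∀ i ∈ s, MDifferentiableAt 𝓘(ℝ, E) 𝓘(ℝ, ℝ) (f i) x) :
    MDifferentiableAt 𝓘(ℝ, E) 𝓘(ℝ, ℝ) (fun y => ∏ i ∈ s, f i y) x ∧ ∀ v,
      mvfderiv 𝓘(ℝ, E) (fun y => ∏ i ∈ s, f i y) x v =
        ∑ i ∈ s, mvfderiv 𝓘(ℝ, E) (f i) x v * ∏ j ∈ s.erase i, f j x := by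
  induction s using Finset.induction_on with
  | empty => exact ⟨by simpa using mdifferentiableAt_const, by simp [mvfderiv_const]⟩
  | insert a s ha ih =>
    obtain ⟨h1, h2⟩ := ih fun i hi => hf i (Finset.mem_insert_of_mem hi)
    have h3 := hf a (Finset.mem_insert_self a s)
    simp only [Finset.prod_insert ha, Finset.sum_insert ha]
    refine ⟨h3.mul h1, fun v => ?_⟩
    have h4 := mvfderiv_mul h3 h1
    rw [show (fun y => f a y * ∏ i ∈ s, f i y) = f a * fun y => ∏ i ∈ s, f i y from rfl, h4]
    simp only [add_apply, smul_apply, smul_eq_mul, h2,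
      Finset.erase_insert ha, Finset.mul_sum]
    rw [add_comm, mul_comm]
    congr 1
    refine Finset.sum_congr rfl fun i hi => ?_
    have hia : a ≠ i := by rintro rfl; exact ha hi
    rw [Finset.erase_insert_of_ne hia, Finset.prod_insert fun h => ha (Finset.mem_of_mem_erase h)]
    ring

theorem mvfderiv_det {ι : Type*} [Fintype ι] [DecidableEq ι] {A : M → Matrix ι ι ℝ} {x : M}
    (hA : ∀ i j, MDifferentiableAt 𝓘(ℝ, E) 𝓘(ℝ, ℝ) (fun y => A y i j) x)
    (v : TangentSpace 𝓘(ℝ, E) x) :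
    mvfderiv 𝓘(ℝ, E) (fun y => (A y).det) x v =
      ∑ j, ((A x).updateCol j fun i => mvfderiv 𝓘(ℝ, E) (fun y => A y i j) x v).det := by
  simp only [Matrix.det_apply']
  have h1 := fun σ : Equiv.Perm ι =>
    mvfderiv_finsetProd (s := Finset.univ) (fun i _ => hA (σ i) i)
  have h2 : ∀ σ : Equiv.Perm ι, mvfderiv 𝓘(ℝ, E)
      (fun y => ((Equiv.Perm.sign σ : ℤ) : ℝ) * ∏ i, A y (σ i) i) x v =
      ((Equiv.Perm.sign σ : ℤ) : ℝ) * ∑ i, mvfderiv 𝓘(ℝ, E) (fun y => A y (σ i) i) x v *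
        ∏ j ∈ Finset.univ.erase i, A x (σ j) j := by
    intro σ
    rw [← (h1 σ).2 v]
    have := mvfderiv_mul (mdifferentiableAt_const (c := ((Equiv.Perm.sign σ : ℤ) : ℝ))) (h1 σ).1
    rw [show (fun y => ((Equiv.Perm.sign σ : ℤ) : ℝ) * ∏ i, A y (σ i) i) =
      (fun _ => ((Equiv.Perm.sign σ : ℤ) : ℝ)) * fun y => ∏ i, A y (σ i) i from rfl, this]
    simp [mvfderiv_const]
  have h3 : ∀ σ : Equiv.Perm ι, MDifferentiableAt 𝓘(ℝ, E) 𝓘(ℝ, ℝ)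
      (fun y => ((Equiv.Perm.sign σ : ℤ) : ℝ) * ∏ i, A y (σ i) i) x :=
    fun σ => mdifferentiableAt_const.mul (h1 σ).1
  rw [(mvfderiv_finsetSum fun σ _ => h3 σ).2, sum_apply, Finset.sum_comm]
  refine Finset.sum_congr rfl fun σ _ => ?_
  rw [h2, Finset.mul_sum]
  refine Finset.sum_congr rfl fun i _ => ?_
  rw [← Finset.mul_prod_erase _ _ (Finset.mem_univ i)]
  congr 2
  · simp
  · refine Finset.prod_congr rfl fun j hj => ?_
    rw [Matrix.updateCol_ne (Finset.ne_of_mem_erase hj)]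

variable [IsManifold 𝓘(ℝ, E) ∞ M] {n : ℕ}

namespace DivergenceFreeWeb.AdaptedFrame

variable {W : DivergenceFreeWeb E M n} {U : Set M} (φ : W.AdaptedFrame U)
  (Γ : W.Index → W.Index → W.Index → M → ℝ)

/-- The connection with the Christoffel symbols `Γ` in an adapted frame. -/
noncomputable def conn (Y : Π x : M, TangentSpace 𝓘(ℝ, E) x) (x : M) :
    TangentSpace 𝓘(ℝ, E) x →L[ℝ] TangentSpace 𝓘(ℝ, E) x :=
  ∑ c, (mvfderiv 𝓘(ℝ, E) (fun y => φ.ξ c y (Y y)) x +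
    ∑ a, ∑ b, (Γ a b c x * φ.ξ b x (Y x)) • φ.ξ a x).smulRight (φ.e c x)

theorem conn_apply (Y : Π x : M, TangentSpace 𝓘(ℝ, E) x) (x : M) (v : TangentSpace 𝓘(ℝ, E) x) :
    φ.conn Γ Y x v = ∑ c, (mvfderiv 𝓘(ℝ, E) (fun y => φ.ξ c y (Y y)) x v +
      ∑ a, ∑ b, Γ a b c x * φ.ξ b x (Y x) * φ.ξ a x v) • φ.e c x := by
  simp [conn]

theorem coframe_sum {x : M} (hx : x ∈ U) (f : W.Index → ℝ) (a : W.Index) :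
    φ.ξ a x (∑ c, f c • φ.e c x) = f a := by
  simp only [map_sum, map_smul, φ.dual x hx, smul_eq_mul, mul_ite, mul_one, mul_zero,
    Finset.sum_ite_eq, Finset.mem_univ, if_true]

theorem coframe_conn {x : M} (hx : x ∈ U) (Y : Π x : M, TangentSpace 𝓘(ℝ, E) x)
    (v : TangentSpace 𝓘(ℝ, E) x) (c : W.Index) :
    φ.ξ c x (φ.conn Γ Y x v) = mvfderiv 𝓘(ℝ, E) (fun y => φ.ξ c y (Y y)) x v +
      ∑ a, ∑ b, Γ a b c x * φ.ξ b x (Y x) * φ.ξ a x v := by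
  rw [conn_apply, φ.coframe_sum hx]

theorem ext_coframe {x : M} (hx : x ∈ U) {v w : TangentSpace 𝓘(ℝ, E) x}
    (h : ∀ a, φ.ξ a x v = φ.ξ a x w) : v = w := by
  rw [← φ.expand x hx v, ← φ.expand x hx w]
  simp only [h]

/-- This fixes the order of the indices of Γ: direction, differentiated field, component. -/
theorem coframe_conn_frame {x : M} (hx : x ∈ U) (a b c : W.Index) :
    φ.ξ c x (φ.conn Γ (φ.e b) x (φ.e a x)) = Γ a b c x := by
  rw [φ.coframe_conn Γ hx, mvfderiv_congr_of_eqOn φ.isOpen (fun y hy => φ.dual y hy c b) hx,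
    mvfderiv_const, zero_apply, zero_add]
  simp [φ.dual x hx]

variable {Γ} in
-- The coefficients of Y in block i vanish identically, hence so do their derivatives, and Γ brings
-- nothing into block i from the other blocks.
theorem conn_mem (hΓ : ∀ a b c x, b.1 ≠ c.1 → Γ a b c x = 0) {i : Fin n} {V : Set M}
    (hV : IsOpen V) (hVU : V ⊆ U) {Y : Π x : M, TangentSpace 𝓘(ℝ, E) x}
    (hY : ∀ x ∈ V, Y x ∈ (W.fol i).tangent x) {x : M} (hx : x ∈ V) (v : TangentSpace 𝓘(ℝ, E) x) :
    φ.conn Γ Y x v ∈ (W.fol i).tangent x := by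
  have h0 : ∀ y ∈ V, ∀ c : W.Index, c.1 = i → φ.ξ c y (Y y) = 0 := fun y hy c hc =>
    (φ.mem_iff y (hVU hy) i _).mp (hY y hy) c hc
  rw [φ.mem_iff x (hVU hx)]
  intro c hc
  rw [φ.coframe_conn Γ (hVU hx), mvfderiv_congr_of_eqOn hV (fun y hy => h0 y hy c hc) hx,
    mvfderiv_const]
  simp only [zero_apply, zero_add]
  refine Finset.sum_eq_zero fun a _ => Finset.sum_eq_zero fun b _ => ?_
  by_cases hb : b.1 = c.1
  · rw [h0 x hx b (hb.trans hc)]; ring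
  · rw [hΓ a b c x hb]; ring

variable {Γ} in
theorem smooth_conn_apply (hΓ : ∀ a b c, IsSmoothFunOn (E := E) (Γ a b c) U)
    {X Y : Π x : M, TangentSpace 𝓘(ℝ, E) x} {V : Set M} (hV : IsOpen V) (hVU : V ⊆ U)
    (hX : IsSmoothFieldOn X V) (hY : IsSmoothFieldOn Y V) :
    IsSmoothFieldOn (fun x => φ.conn Γ Y x (X x)) V := by
  simp only [conn_apply]
  refine IsSmoothFieldOn.sum fun c _ => IsSmoothFieldOn.smul ?_ ((φ.smooth c).mono hVU)
  refine ((φ.smooth_coeff hV hVU hY c).lieDer hX hV).add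
    (isSmoothFunOn_sum fun a _ => isSmoothFunOn_sum fun b _ => ?_)
  exact (((hΓ a b c).mono hVU).mul (φ.smooth_coeff hV hVU hY b)).mul (φ.smooth_coeff hV hVU hX a)

variable [FiniteDimensional ℝ E]

theorem isCovariantDerivativeOn_conn : IsCovariantDerivativeOn E (φ.conn Γ) U where
  add {Y Y' x} hY hY' hx := by
    ext v
    refine φ.ext_coframe hx fun c => ?_
    rw [add_apply, map_add]
    simp only [φ.coframe_conn Γ hx]
    have h := mvfderiv_add (φ.mdiffAt_coeff hx hY c) (φ.mdiffAt_coeff hx hY' c)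
    rw [show (fun y => φ.ξ c y ((Y + Y') y)) =
      (fun y => φ.ξ c y (Y y)) + fun y => φ.ξ c y (Y' y) by ext y; simp, h]
    simp only [Pi.add_apply, map_add, mul_add, add_mul, Finset.sum_add_distrib,
      add_apply]
    ring
  leibniz {Y f x} hY hf hx := by
    ext v
    refine φ.ext_coframe hx fun c => ?_
    rw [add_apply, map_add, smul_apply, map_smul]
    simp only [φ.coframe_conn Γ hx]
    have h := mvfderiv_mul hf (φ.mdiffAt_coeff hx hY c)
    rw [show (fun y => φ.ξ c y ((f • Y) y)) =
      f * fun y => φ.ξ c y (Y y) by ext y; simp, h]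
    simp only [Pi.smul_apply', map_smul, smul_eq_mul, mul_add, Finset.mul_sum,
      add_apply, smul_apply,
      ContinuousLinearMap.smulRight_apply]
    have : ∀ a b, Γ a b c x * (f x * φ.ξ b x (Y x)) * φ.ξ a x v =
        f x * (Γ a b c x * φ.ξ b x (Y x) * φ.ξ a x v) := fun a b => by ring
    simp only [this]
    ring

variable {Γ}

theorem contMDiffCovariantDerivativeOn_conn (hΓ : ∀ a b c, IsSmoothFunOn (E := E) (Γ a b c) U) :
    ContMDiffCovariantDerivativeOn E ∞ (φ.conn Γ) U where
  contMDiff {Y} hY x hx := by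
    let t := trivializationAt E (TangentSpace 𝓘(ℝ, E) : M → Type _) x
    have hV : IsOpen (U ∩ t.baseSet) := φ.isOpen.inter t.open_baseSet
    refine (contMDiffAt_hom_of_apply_localFrame (Module.finBasis ℝ E) fun l => ?_).contMDiffWithinAt
    exact (φ.smooth_conn_apply hΓ hV Set.inter_subset_left
      ((t.contMDiffOn_localFrame_baseSet (I := 𝓘(ℝ, E)) ∞ _ l).mono Set.inter_subset_right)
      (IsSmoothFieldOn.mono hY Set.inter_subset_left)).contMDiffAt hV
        ⟨hx, mem_baseSet_trivializationAt _ _ _⟩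

/-- Torsion is tensorial in each argument, so it vanishes as soon as it vanishes on pairs of frame
fields; there it is the hypothesis on Γ. -/
theorem conn_torsion (hΓ : ∀ a b c, ∀ x ∈ U, Γ a b c x - Γ b a c x = φ.bracketCoeff a b c x)
    {X Y : Π x : M, TangentSpace 𝓘(ℝ, E) x} {x : M} (hx : x ∈ U)
    (hX : MDifferentiableAt 𝓘(ℝ, E) (𝓘(ℝ, E).prod 𝓘(ℝ, E))
      (fun y => (⟨y, X y⟩ : TangentBundle 𝓘(ℝ, E) M)) x)
    (hY : MDifferentiableAt 𝓘(ℝ, E) (𝓘(ℝ, E).prod 𝓘(ℝ, E))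
      (fun y => (⟨y, Y y⟩ : TangentBundle 𝓘(ℝ, E) M)) x) :
    φ.conn Γ Y x (X x) - φ.conn Γ X x (Y x) = VectorField.mlieBracket 𝓘(ℝ, E) X Y x := by
  have : CompleteSpace E := FiniteDimensional.complete ℝ E
  have hcov := φ.isCovariantDerivativeOn_conn Γ
  let T (X Y : Π x : M, TangentSpace 𝓘(ℝ, E) x) : TangentSpace 𝓘(ℝ, E) x :=
    φ.conn Γ Y x (X x) - φ.conn Γ X x (Y x) - VectorField.mlieBracket 𝓘(ℝ, E) X Y x
  have h₁ : ∀ Y, TensorialAt 𝓘(ℝ, E) E (T · Y) x := fun Y =>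
    { smul := fun hf hX => by
        simp [T, hcov.leibniz hX hf hx, VectorField.mlieBracket_smul_left hf hX]
        module
      add := fun hX hX' => by
        simp [T, hcov.add hX hX' hx, VectorField.mlieBracket_add_left hX hX']
        module }
  have h₂ : ∀ X, TensorialAt 𝓘(ℝ, E) E (T X ·) x := fun X =>
    { smul := fun hf hY => by
        simp [T, hcov.leibniz hY hf hx, VectorField.mlieBracket_smul_right hf hY]
        module
      add := fun hY hY' => by
        simp [T, hcov.add hY hY' hx, VectorField.mlieBracket_add_right hY hY']
        module }
  have he : ∀ a, MDifferentiableAt 𝓘(ℝ, E) (𝓘(ℝ, E).prod 𝓘(ℝ, E))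
      (fun y => (⟨y, φ.e a y⟩ : TangentBundle 𝓘(ℝ, E) M)) x :=
    fun a => (φ.smooth a).mdiffAt φ.isOpen hx
  have hce : ∀ a (r : ℝ), MDifferentiableAt 𝓘(ℝ, E) (𝓘(ℝ, E).prod 𝓘(ℝ, E))
      (fun y => (⟨y, ((fun _ : M => r) • φ.e a) y⟩ : TangentBundle 𝓘(ℝ, E) M)) x :=
    fun a r => mdifferentiableAt_const.smul_section (he a)
  have hframe : ∀ a b, T (φ.e a) (φ.e b) = 0 := by
    intro a b
    refine φ.ext_coframe hx fun c => ?_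
    simp only [T, map_sub, φ.coframe_conn_frame Γ hx, map_zero]
    rw [hΓ a b c x hx, bracketCoeff, sub_self]
  -- A tensorial operator sees only the value of Z at x, so Z may be replaced by the combination of
  -- frame fields with constant coefficients ξ_a(Z x).
  have hexp : ∀ (S : (Π x : M, TangentSpace 𝓘(ℝ, E) x) → TangentSpace 𝓘(ℝ, E) x),
      TensorialAt 𝓘(ℝ, E) E S x → (∀ a, S (φ.e a) = 0) → ∀ Z : Π x : M, TangentSpace 𝓘(ℝ, E) x,
      MDifferentiableAt 𝓘(ℝ, E) (𝓘(ℝ, E).prod 𝓘(ℝ, E))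
        (fun y => (⟨y, Z y⟩ : TangentBundle 𝓘(ℝ, E) M)) x → S Z = 0 := by
    intro S hS hS0 Z hZ
    have hsum := hS.sum (s := Finset.univ) (fun a => (fun _ : M => φ.ξ a x (Z x)) • φ.e a)
      fun a _ => hce a _
    rw [hS.pointwise hZ (MDifferentiableAt.sum_section fun a _ => hce a _) (φ.expand x hx _).symm,
      hsum]
    refine Finset.sum_eq_zero fun a _ => ?_
    rw [hS.smul mdifferentiableAt_const (he a), hS0, smul_zero]
  exact sub_eq_zero.mp (hexp _ (h₁ Y) (fun a => hexp _ (h₂ _) (hframe a) Y hY) X hX)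

end DivergenceFreeWeb.AdaptedFrame

end LocalConnection

/-! ### Local existence of web connections -/

section LocalExistence

open Bundle

variable {E : Type*} [NormedAddCommGroup E] [NormedSpace ℝ E]
  {M : Type*} [TopologicalSpace M] [ChartedSpace E M] [IsManifold 𝓘(ℝ, E) ∞ M] {n : ℕ}

namespace DivergenceFreeWeb

namespace AdaptedFrame

variable {W : DivergenceFreeWeb E M n} {U : Set M} (φ : W.AdaptedFrame U)
  {Γ : W.Index → W.Index → W.Index → M → ℝ}

/-- An enumeration of the indices of the adapted frames of a web. -/
noncomputable def _root_.DivergenceFreeWeb.indexEquiv (W : DivergenceFreeWeb E M n) :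
    Fin (Module.finrank ℝ E) ≃ W.Index :=
  Fintype.equivOfCardEq (by rw [W.card_index, Fintype.card_fin])

/-- The basis of the tangent space at `x` given by an adapted frame. -/
noncomputable def basis {x : M} (hx : x ∈ U) :
    Module.Basis (Fin (Module.finrank ℝ E)) ℝ (TangentSpace 𝓘(ℝ, E) x) :=
  Module.Basis.reindex (Module.Basis.ofEquivFun
    { toFun := fun v a => φ.ξ a x v
      map_add' := fun v w => by ext a; simp
      map_smul' := fun r v => by ext a; simp
      invFun := fun f => ∑ a, f a • φ.e a x
      left_inv := fun v => φ.expand x hx v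
      right_inv := fun f => funext fun a => φ.coframe_sum hx f a }) W.indexEquiv.symm

theorem basis_repr {x : M} (hx : x ∈ U) (v : TangentSpace 𝓘(ℝ, E) x) (k) :
    (φ.basis hx).repr v k = φ.ξ (W.indexEquiv k) x v := by
  simp [basis]

theorem basis_apply {x : M} (hx : x ∈ U) (k) :
    φ.basis hx k = φ.e (W.indexEquiv k) x := by
  refine φ.ext_coframe hx fun a => ?_
  obtain ⟨l, rfl⟩ := W.indexEquiv.surjective a
  rw [← φ.basis_repr hx, Module.Basis.repr_self, φ.dual x hx, Finsupp.single_apply]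
  simp [eq_comm]

/-- The value of the volume form on the frame. -/
noncomputable def volFun (φ : W.AdaptedFrame U) (x : M) : ℝ :=
  W.vol.toForm x fun k => φ.e (W.indexEquiv k) x

theorem smooth_volFun : IsSmoothFunOn (E := E) φ.volFun U :=
  W.vol.smooth U φ.isOpen _ fun _ => φ.smooth _

/-- The matrix of the components of a family of fields. -/
noncomputable def coeffMatrix (φ : W.AdaptedFrame U) {x : M}
    (Y : Fin (Module.finrank ℝ E) → TangentSpace 𝓘(ℝ, E) x) :
    Matrix (Fin (Module.finrank ℝ E)) (Fin (Module.finrank ℝ E)) ℝ :=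
  Matrix.of fun k j => φ.ξ (W.indexEquiv k) x (Y j)

theorem vol_eq {x : M} (hx : x ∈ U) (Y : Fin (Module.finrank ℝ E) → TangentSpace 𝓘(ℝ, E) x) :
    W.vol.toForm x Y = φ.volFun x * (φ.coeffMatrix Y).det := by
  conv_lhs => rw [(W.vol.toForm x).eq_smul_basis_det (φ.basis hx)]
  rw [AlternatingMap.smul_apply, smul_eq_mul, Module.Basis.det_apply, volFun]
  rw [show (φ.basis hx : _ → _) = fun k => φ.e (W.indexEquiv k) x from
    funext fun k => φ.basis_apply hx k]
  congr 2

theorem volFun_ne_zero {x : M} (hx : x ∈ U) : φ.volFun x ≠ 0 := by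
  intro h
  refine W.vol.ne_zero x (AlternatingMap.ext fun Y => ?_)
  rw [φ.vol_eq hx, h, zero_mul]
  rfl

theorem coeffMatrix_update {x : M} (Y : Fin (Module.finrank ℝ E) → TangentSpace 𝓘(ℝ, E) x) (j)
    (v : TangentSpace 𝓘(ℝ, E) x) :
    φ.coeffMatrix (Function.update Y j v) =
      (φ.coeffMatrix Y).updateCol j fun k => φ.ξ (W.indexEquiv k) x v := by
  ext k l
  by_cases h : l = j
  · subst h; simp [coeffMatrix]
  · simp [coeffMatrix, h]

/-- Write Ω(Y₁, …, Y_m) = w det A, with w the value of Ω on the frame and A the matrix of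
components. Differentiating gives dw · det A plus w times the sum of determinants with one column
differentiated. The connection yields the same sum plus w tr(G) det A, where G is the connection
matrix in the direction v. The hypothesis on Γ says w tr G = dw(v). -/
theorem conn_vol
    (hΓ : ∀ a, ∀ x ∈ U, φ.volFun x * ∑ b, Γ a b b x = lieDer (φ.e a) φ.volFun x)
    {V : Set M} (hV : IsOpen V) (hVU : V ⊆ U)
    {Y : Fin (Module.finrank ℝ E) → Π x : M, TangentSpace 𝓘(ℝ, E) x}
    (hY : ∀ j, IsSmoothFieldOn (Y j) V) {x : M} (hx : x ∈ V) (v : TangentSpace 𝓘(ℝ, E) x) :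
    mvfderiv 𝓘(ℝ, E) (fun y => W.vol.toForm y (fun j => Y j y)) x v =
      ∑ j, W.vol.toForm x (Function.update (fun k => Y k x) j (φ.conn Γ (Y j) x v)) := by
  have hxU := hVU hx
  let A : M → Matrix (Fin (Module.finrank ℝ E)) (Fin (Module.finrank ℝ E)) ℝ :=
    fun y => φ.coeffMatrix fun j => Y j y
  have hA : ∀ k j, MDifferentiableAt 𝓘(ℝ, E) 𝓘(ℝ, ℝ) (fun y => A y k j) x := fun k j =>
    (φ.smooth_coeff hV hVU (hY j) _).mdiffAt hV hx
  have hdetA : MDifferentiableAt 𝓘(ℝ, E) 𝓘(ℝ, ℝ) (fun y => (A y).det) x :=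
    (isSmoothFunOn_det fun k j => φ.smooth_coeff hV hVU (hY j) _).mdiffAt hV hx
  have hw : MDifferentiableAt 𝓘(ℝ, E) 𝓘(ℝ, ℝ) φ.volFun x := φ.smooth_volFun.mdiffAt φ.isOpen hxU
  let G : Matrix (Fin (Module.finrank ℝ E)) (Fin (Module.finrank ℝ E)) ℝ :=
    Matrix.of fun k l => ∑ a, Γ a (W.indexEquiv l) (W.indexEquiv k) x * φ.ξ a x v
  have htrace : φ.volFun x * G.trace = mvfderiv 𝓘(ℝ, E) φ.volFun x v := by
    have h1 : G.trace = ∑ a, (∑ b, Γ a b b x) * φ.ξ a x v := by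
      simp only [Matrix.trace, Matrix.diag, G, Matrix.of_apply, Finset.sum_mul]
      rw [Finset.sum_comm]
      exact Finset.sum_congr rfl fun a _ =>
        W.indexEquiv.sum_comp fun b => Γ a b b x * φ.ξ a x v
    rw [h1, Finset.mul_sum]
    conv_rhs => rw [← φ.expand x hxU v]
    rw [map_sum]
    refine Finset.sum_congr rfl fun a _ => ?_
    rw [map_smul, ← mul_assoc, hΓ a x hxU, smul_eq_mul, mul_comm]
    rfl
  have hcol : ∀ j, (fun k => φ.ξ (W.indexEquiv k) x (φ.conn Γ (Y j) x v)) =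
      (fun k => mvfderiv 𝓘(ℝ, E) (fun y => A y k j) x v) + G.mulVec fun k => A x k j := by
    intro j
    funext k
    rw [φ.coframe_conn Γ hxU]
    simp only [Pi.add_apply, Matrix.mulVec, dotProduct, G, Matrix.of_apply, A, coeffMatrix,
      Finset.sum_mul]
    congr 1
    rw [Finset.sum_comm, ← W.indexEquiv.sum_comp]
    exact Finset.sum_congr rfl fun l _ => Finset.sum_congr rfl fun a _ => by ring
  have hterm : ∀ j, W.vol.toForm x (Function.update (fun k => Y k x) j (φ.conn Γ (Y j) x v)) =
      φ.volFun x * (((A x).updateCol j fun k => mvfderiv 𝓘(ℝ, E) (fun y => A y k j) x v).det +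
        ((A x).updateCol j (G.mulVec fun k => A x k j)).det) := by
    intro j
    rw [φ.vol_eq hxU, φ.coeffMatrix_update, hcol, Matrix.det_updateCol_add]
  have hmul := mvfderiv_mul hw hdetA
  rw [mvfderiv_congr_of_eqOn hV (fun y hy => φ.vol_eq (hVU hy) _) hx,
    show (fun y => φ.volFun y * (φ.coeffMatrix fun j => Y j y).det) =
      φ.volFun * fun y => (A y).det from rfl, hmul]
  simp only [hterm, ← Finset.mul_sum, Finset.sum_add_distrib]
  rw [Matrix.sum_det_updateCol_mulVec, ← mvfderiv_det hA, mul_add, ← mul_assoc, htrace]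
  simp only [add_apply, smul_apply, smul_eq_mul]
  ring

/-! #### The Christoffel symbols of a web connection -/

/-- The Christoffel symbols of a torsionless connection for which the foliations are parallel. -/
noncomputable def torsionlessSymbol (a b c : W.Index) (x : M) : ℝ :=
  if b.1 = c.1 then (if a.1 = b.1 then φ.bracketCoeff a b c x / 2 else φ.bracketCoeff a b c x)
  else 0

/-- The defect of parallelism of the volume form. -/
noncomputable def divergence (a : W.Index) (x : M) : ℝ :=
  lieDer (φ.e a) φ.volFun x / φ.volFun x - ∑ b, φ.torsionlessSymbol a b b x

/-- The Christoffel symbols of a web connection. -/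
noncomputable def webSymbol (a b c : W.Index) (x : M) : ℝ :=
  φ.torsionlessSymbol a b c x + if a.1 = b.1 ∧ b.1 = c.1 then
    ((if b = c then φ.divergence a x else 0) + (if a = c then φ.divergence b x else 0)) /
      ((W.fol a.1).codim + 1) else 0

theorem webSymbol_of_ne {a b c : W.Index} (h : b.1 ≠ c.1) (x : M) : φ.webSymbol a b c x = 0 := by
  simp [webSymbol, torsionlessSymbol, h]

/-- The term with `divergence` is symmetric in a and b and cancels. Within one block two halves of
the bracket coefficient add up; across two blocks at most one of the two symbols is nonzero, and it
is the whole coefficient up to sign. If c is in the block of neither a nor b, involutivity makes the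
coefficient zero. -/
theorem webSymbol_sub {x : M} (hx : x ∈ U) (a b c : W.Index) :
    φ.webSymbol a b c x - φ.webSymbol b a c x = φ.bracketCoeff a b c x := by
  have hswap := φ.bracketCoeff_swap b a c x
  by_cases hab : a.1 = b.1
  · by_cases hbc : b.1 = c.1
    · simp only [webSymbol, torsionlessSymbol, hab, hbc, if_true, and_self, hswap]
      ring
    · have h := φ.bracketCoeff_eq_zero (a := a) (b := b) (c := c)
        (fun h => hbc (h.trans hab).symm) (fun h => hbc h.symm) hx
      have hac : a.1 ≠ c.1 := hab ▸ hbc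
      rw [φ.webSymbol_of_ne hbc, φ.webSymbol_of_ne hac, h, sub_zero]
  · have hba : ¬ b.1 = a.1 := fun h => hab h.symm
    by_cases hbc : b.1 = c.1
    · have hac : a.1 ≠ c.1 := hbc ▸ hab
      rw [φ.webSymbol_of_ne hac]
      simp [webSymbol, torsionlessSymbol, hbc, hac]
    · by_cases hac : a.1 = c.1
      · rw [φ.webSymbol_of_ne hbc]
        simp [webSymbol, torsionlessSymbol, hac, hbc, hswap]
      · rw [φ.webSymbol_of_ne hbc, φ.webSymbol_of_ne hac,
          φ.bracketCoeff_eq_zero (Ne.symm hac) (Ne.symm hbc) hx, sub_zero]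

/-- In the trace, `divergence a` occurs once for each index b of the block of a, and once more for b
= a. This is codim + 1 times, whence the denominator in `webSymbol`. -/
theorem sum_webSymbol {x : M} (hx : x ∈ U) (a : W.Index) :
    φ.volFun x * ∑ b, φ.webSymbol a b b x = lieDer (φ.e a) φ.volFun x := by
  have h1 : ∀ b : W.Index, (if a.1 = b.1 ∧ b.1 = b.1 then
      ((if b = b then φ.divergence a x else 0) + (if a = b then φ.divergence b x else 0)) /
        (((W.fol a.1).codim : ℝ) + 1) else 0) =
      (if a.1 = b.1 then φ.divergence a x / ((W.fol a.1).codim + 1) else 0) +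
        if a = b then φ.divergence a x / ((W.fol a.1).codim + 1) else 0 := by
    intro b
    by_cases hab : a = b
    · subst hab; simp [add_div]
    · by_cases h : a.1 = b.1 <;> simp [hab, h]
  have h2 : ∑ b : W.Index, (if a.1 = b.1 then φ.divergence a x / ((W.fol a.1).codim + 1) else 0) =
      (W.fol a.1).codim * (φ.divergence a x / ((W.fol a.1).codim + 1)) := by
    rw [Fintype.sum_sigma, Finset.sum_eq_single a.1]
    · simp
    · intro i _ hi
      simp [hi.symm]
    · simp
  have h3 : ∑ b, φ.webSymbol a b b x = ∑ b, φ.torsionlessSymbol a b b x + φ.divergence a x := by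
    unfold webSymbol
    rw [Finset.sum_add_distrib, Finset.sum_congr rfl fun b _ => h1 b, Finset.sum_add_distrib, h2,
      Finset.sum_ite_eq, if_pos (Finset.mem_univ _)]
    have : ((W.fol a.1).codim : ℝ) + 1 ≠ 0 := by positivity
    field_simp
  have h4 := φ.volFun_ne_zero hx
  rw [h3, divergence]
  field_simp
  ring

variable [FiniteDimensional ℝ E]

theorem smooth_torsionlessSymbol (a b c : W.Index) :
    IsSmoothFunOn (E := E) (φ.torsionlessSymbol a b c) U := by
  unfold torsionlessSymbol
  have h := φ.smooth_bracketCoeff a b c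
  split_ifs
  · exact h.div (isSmoothFunOn_const 2) fun _ _ => two_ne_zero
  · exact h
  · exact isSmoothFunOn_const 0

theorem smooth_divergence (a : W.Index) : IsSmoothFunOn (E := E) (φ.divergence a) U :=
  ((φ.smooth_volFun.lieDer (φ.smooth a) φ.isOpen).div φ.smooth_volFun
    fun _ hy => φ.volFun_ne_zero hy).sub
    (isSmoothFunOn_sum fun b _ => φ.smooth_torsionlessSymbol a b b)

theorem smooth_webSymbol (a b c : W.Index) : IsSmoothFunOn (E := E) (φ.webSymbol a b c) U := by
  have h0 : IsSmoothFunOn (E := E) (fun _ : M => (0 : ℝ)) U := isSmoothFunOn_const 0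
  refine (φ.smooth_torsionlessSymbol a b c).add ?_
  split_ifs
  · exact ((φ.smooth_divergence a).add (φ.smooth_divergence b)).div
      (isSmoothFunOn_const _) fun _ _ => by positivity
  · exact ((φ.smooth_divergence a).add h0).div (isSmoothFunOn_const _) fun _ _ => by positivity
  · exact (h0.add (φ.smooth_divergence b)).div (isSmoothFunOn_const _) fun _ _ => by positivity
  · exact (h0.add h0).div (isSmoothFunOn_const _) fun _ _ => by positivity
  · exact h0

end AdaptedFrame

/-- `cov` is a web connection on the open set `U`. -/
structure IsWebConnectionOn (W : DivergenceFreeWeb E M n)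
    (cov : (Π x : M, TangentSpace 𝓘(ℝ, E) x) →
    Π x : M, TangentSpace 𝓘(ℝ, E) x →L[ℝ] TangentSpace 𝓘(ℝ, E) x) (U : Set M) : Prop where
  isCovariantDerivativeOn : IsCovariantDerivativeOn E cov U
  smooth : ContMDiffCovariantDerivativeOn E ∞ cov U
  torsionless : ∀ X Y : Π x : M, TangentSpace 𝓘(ℝ, E) x, ∀ x ∈ U,
    MDifferentiableAt 𝓘(ℝ, E) (𝓘(ℝ, E).prod 𝓘(ℝ, E))
      (fun y => (⟨y, X y⟩ : TangentBundle 𝓘(ℝ, E) M)) x →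
    MDifferentiableAt 𝓘(ℝ, E) (𝓘(ℝ, E).prod 𝓘(ℝ, E))
      (fun y => (⟨y, Y y⟩ : TangentBundle 𝓘(ℝ, E) M)) x →
    cov Y x (X x) - cov X x (Y x) = VectorField.mlieBracket 𝓘(ℝ, E) X Y x
  fol_parallel : ∀ i (V : Set M), IsOpen V → V ⊆ U → ∀ Y : Π x : M, TangentSpace 𝓘(ℝ, E) x,
    (∀ x ∈ V, Y x ∈ (W.fol i).tangent x) → ∀ x ∈ V, ∀ v, cov Y x v ∈ (W.fol i).tangent x
  vol_parallel : ∀ V : Set M, IsOpen V → V ⊆ U →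
    ∀ Y : Fin (Module.finrank ℝ E) → Π x : M, TangentSpace 𝓘(ℝ, E) x,
    (∀ j, IsSmoothFieldOn (Y j) V) → ∀ x ∈ V, ∀ v : TangentSpace 𝓘(ℝ, E) x,
      mvfderiv 𝓘(ℝ, E) (fun y => W.vol.toForm y (fun j => Y j y)) x v =
        ∑ j, W.vol.toForm x (Function.update (fun k => Y k x) j (cov (Y j) x v))

theorem exists_isWebConnectionOn [FiniteDimensional ℝ E] (W : DivergenceFreeWeb E M n) (x₀ : M) :
    ∃ U, IsOpen U ∧ x₀ ∈ U ∧ ∃ cov, W.IsWebConnectionOn cov U := by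
  obtain ⟨U, hx₀, ⟨φ⟩⟩ := W.exists_adaptedFrame x₀
  exact ⟨U, φ.isOpen, hx₀, φ.conn φ.webSymbol,
    { isCovariantDerivativeOn := φ.isCovariantDerivativeOn_conn _
      smooth := φ.contMDiffCovariantDerivativeOn_conn φ.smooth_webSymbol
      torsionless := fun X Y x hx hX hY =>
        φ.conn_torsion (fun a b c x hx => φ.webSymbol_sub hx a b c) hx hX hY
      fol_parallel := fun i V hV hVU Y hY x hx v =>
        φ.conn_mem (fun a b c x h => φ.webSymbol_of_ne h x) hV hVU hY hx v
      vol_parallel := fun V hV hVU Y hY x hx v =>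
        φ.conn_vol (fun a x hx => φ.sum_webSymbol hx a) hV hVU hY hx v }⟩

end DivergenceFreeWeb

end LocalExistence

/-! ### Global existence of web connections -/

section GlobalExistence

open Bundle

variable {E : Type*} [NormedAddCommGroup E] [NormedSpace ℝ E] [FiniteDimensional ℝ E]
  {M : Type*} [TopologicalSpace M] [ChartedSpace E M] [IsManifold 𝓘(ℝ, E) ∞ M] {n : ℕ}

namespace DivergenceFreeWeb

/-- Each defining condition of a web connection is affine or linear in the connection, so it
survives the combination ∑ ρ_p cov_p with ∑ ρ_p = 1. -/
theorem exists_isWebConnection [T2Space M] [SigmaCompactSpace M] (W : DivergenceFreeWeb E M n) :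
    ∃ Θ, W.IsWebConnection Θ := by
  choose U hUo hxU cov hcov using W.exists_isWebConnectionOn
  obtain ⟨ρ, hρ⟩ := SmoothPartitionOfUnity.exists_isSubordinate 𝓘(ℝ, E) isClosed_univ U hUo
    fun x _ => Set.mem_iUnion.mpr ⟨x, hxU x⟩
  have hmem : ∀ {x p}, p ∈ ρ.finsupport x → x ∈ U p := fun {x p} hp =>
    hρ p (subset_tsupport _ ((ρ.mem_finsupport x).mp hp))
  have hsum : ∀ x, ∑ p ∈ ρ.finsupport x, ρ p x = 1 := fun x => ρ.sum_finsupport x (Set.mem_univ x)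
  let glue (Y : Π x : M, TangentSpace 𝓘(ℝ, E) x) (x : M) :
      TangentSpace 𝓘(ℝ, E) x →L[ℝ] TangentSpace 𝓘(ℝ, E) x := ∑ᶠ p, ρ p x • cov p Y x
  have hglue : ∀ Y x, glue Y x = ∑ p ∈ ρ.finsupport x, ρ p x • cov p Y x := fun Y x =>
    (finsum_eq_sum_of_support_subset _ fun p hp => by
      simp only [ρ.coe_finsupport, Function.mem_support] at hp ⊢
      exact fun h => hp (by rw [h, zero_smul]))
  have hglue_apply : ∀ Y x v, glue Y x v = ∑ p ∈ ρ.finsupport x, ρ p x • cov p Y x v :=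
    fun Y x v => by rw [hglue]; simp
  have hconst : ∀ x (v : TangentSpace 𝓘(ℝ, E) x), ∑ p ∈ ρ.finsupport x, ρ p x • v = v :=
    fun x v => by rw [← Finset.sum_smul, hsum, one_smul]
  have hisCov : IsCovariantDerivativeOn E glue Set.univ :=
    { add := fun {Y Y' x} hY hY' _ => by
        simp only [hglue, ← Finset.sum_add_distrib, ← smul_add]
        exact Finset.sum_congr rfl fun p hp => by
          rw [(hcov p).isCovariantDerivativeOn.add hY hY' (hmem hp)]
      leibniz := fun {Y g x} hY hg _ => by
        ext v
        rw [add_apply, smul_apply]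
        simp only [hglue_apply]
        -- The derivative of g enters every summand, so ∑ ρ_p = 1 is what leaves it exactly once.
        rw [Finset.smul_sum, ContinuousLinearMap.smulRight_apply,
          ← hconst x (mvfderiv 𝓘(ℝ, E) g x v • Y x), ← Finset.sum_add_distrib]
        refine Finset.sum_congr rfl fun p hp => ?_
        rw [(hcov p).isCovariantDerivativeOn.leibniz hY hg (hmem hp)]
        simp only [add_apply, smul_apply, ContinuousLinearMap.smulRight_apply]
        module }
  refine ⟨⟨glue, hisCov⟩, ⟨⟨fun {Y} hY x _ => ?_⟩⟩, ?_, ?_, ?_⟩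
  · refine ContMDiffAt.contMDiffWithinAt ?_
    refine ContMDiffAt.finsum_section_of_locallyFinite
      (V := fun x : M => TangentSpace 𝓘(ℝ, E) x →L[ℝ] TangentSpace 𝓘(ℝ, E) x)
      (t := fun p x => ρ p x • cov p Y x) ?_ fun p => ?_
    · refine ρ.locallyFinite.subset fun p y hy => ?_
      exact fun h => hy (by simp only [h, zero_smul])
    · by_cases hx : x ∈ tsupport (ρ p)
      · exact ContMDiffAt.smul_section (ρ p).contMDiff.contMDiffAt
          (((hcov p).smooth.contMDiff (hY.mono (Set.subset_univ _))).contMDiffAt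
            ((hUo p).mem_nhds (hρ p hx)))
      -- Off the support of ρ_p nothing is known about cov_p, but the product is zero near x.
      · refine ContMDiffAt.congr_of_eventuallyEq ((contMDiff_zeroSection ℝ
          (fun x : M => TangentSpace 𝓘(ℝ, E) x →L[ℝ] TangentSpace 𝓘(ℝ, E) x)).contMDiffAt.of_le
          le_top) ?_
        filter_upwards [(isClosed_tsupport (ρ p)).isOpen_compl.mem_nhds hx] with y hy
        rw [image_eq_zero_of_notMem_tsupport hy, zero_smul]
        rfl
  · have : CompleteSpace E := FiniteDimensional.complete ℝ E
    rw [CovariantDerivative.torsion_eq_zero_iff]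
    intro X Y x hX hY
    change glue Y x (X x) - glue X x (Y x) = _
    rw [hglue_apply, hglue_apply, ← Finset.sum_sub_distrib,
      ← hconst x (VectorField.mlieBracket 𝓘(ℝ, E) X Y x)]
    refine Finset.sum_congr rfl fun p hp => ?_
    rw [← smul_sub, (hcov p).torsionless X Y x (hmem hp) hX hY]
  · intro i V hV Y _ x hx v
    change glue Y.toVF x v ∈ _
    rw [hglue_apply]
    refine Submodule.sum_mem _ fun p hp => Submodule.smul_mem _ _ ?_
    exact (hcov p).fol_parallel i (V ∩ U p) (hV.inter (hUo p)) Set.inter_subset_right Y.toVF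
      (fun y _ => (Y y).2) x ⟨hx, hmem hp⟩ v
  · intro V hV Y hY x hx v
    change _ = ∑ j, W.vol.toForm x (Function.update (fun k => Y k x) j (glue (Y j) x v))
    have h1 : ∀ j, W.vol.toForm x (Function.update (fun k => Y k x) j (glue (Y j) x v)) =
        ∑ p ∈ ρ.finsupport x, ρ p x •
          W.vol.toForm x (Function.update (fun k => Y k x) j (cov p (Y j) x v)) := fun j => by
      rw [hglue_apply, AlternatingMap.map_update_sum]
      simp only [AlternatingMap.map_update_smul]
    simp only [h1]
    rw [Finset.sum_comm]
    simp only [← Finset.smul_sum]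
    rw [← one_smul ℝ (mvfderiv 𝓘(ℝ, E) (fun y => W.vol.toForm y fun j => Y j y) x v), ← hsum x,
      Finset.sum_smul]
    refine Finset.sum_congr rfl fun p hp => ?_
    rw [(hcov p).vol_parallel (V ∩ U p) (hV.inter (hUo p)) Set.inter_subset_right Y
      (fun j => (hY j).mono Set.inter_subset_left) x ⟨hx, hmem hp⟩ v]

end DivergenceFreeWeb

end GlobalExistence

/-! ### Contraction of decomposable multivectors -/

section Contraction

variable {V : Type*} [AddCommGroup V] [Module ℝ V]

theorem contraction_ιMulti_cast {m p q : ℕ} (h : m = p + q) (Ω : V [⋀^Fin m]→ₗ[ℝ] ℝ)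
    (A B : Submodule ℝ V) (v : Fin p → A) (w : Fin q → B) :
    contraction Ω A B p q (exteriorPower.ιMulti ℝ p v) w =
      Ω (fun k => Fin.append (fun j => (v j : V)) (fun j => (w j : V)) (Fin.cast h k)) := by
  subst h
  exact contraction_ιMulti Ω A B v w

theorem Fin.update_append_castAdd {α : Type*} {p q : ℕ} (v : Fin p → α) (w : Fin q → α) (j : Fin p)
    (z : α) : Function.update (Fin.append v w) (Fin.castAdd q j) z =
      Fin.append (Function.update v j z) w := by
  funext k
  refine Fin.addCases (fun i => ?_) (fun i => ?_) k
  · by_cases h : i = j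
    · subst h; simp
    · simp [h]
  · rw [Function.update_of_ne (by simp [Fin.ext_iff]; omega)]
    simp

theorem Fin.update_append_natAdd {α : Type*} {p q : ℕ} (v : Fin p → α) (w : Fin q → α) (j : Fin q)
    (z : α) : Function.update (Fin.append v w) (Fin.natAdd p j) z =
      Fin.append v (Function.update w j z) := by
  funext k
  refine Fin.addCases (fun i => ?_) (fun i => ?_) k
  · rw [Function.update_of_ne (by simp [Fin.ext_iff]; omega)]
    simp
  · by_cases h : i = j
    · subst h; simp
    · simp [h]

theorem Submodule.coe_comp_update {A : Submodule ℝ V} {p : ℕ} (v : Fin p → A) (j : Fin p) (z : A) :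
    (fun k => (Function.update v j z k : V)) = Function.update (fun k => (v k : V)) j z := by
  funext k
  by_cases h : k = j
  · subst h; simp
  · simp [h]

/-- This is the Leibniz sum for Ω on a concatenated family, split into the slots filled from A and
those filled from B. -/
theorem sum_update_append {m p q : ℕ} (h : m = p + q) (Ω : V [⋀^Fin m]→ₗ[ℝ] ℝ)
    (A B : Submodule ℝ V) (v v' : Fin p → A) (w w' : Fin q → B) :
    ∑ k, Ω (Function.update (fun k => Fin.append (fun j => (v j : V)) (fun j => (w j : V))
        (Fin.cast h k)) k
        (Fin.append (fun j => (v' j : V)) (fun j => (w' j : V)) (Fin.cast h k))) =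
      ∑ j, contraction Ω A B p q (exteriorPower.ιMulti ℝ p (Function.update v j (v' j))) w +
      ∑ j, contraction Ω A B p q (exteriorPower.ιMulti ℝ p v) (Function.update w j (w' j)) := by
  subst h
  simp only [Fin.cast_eq_self]
  rw [Fin.sum_univ_add]
  simp only [contraction_ιMulti, Submodule.coe_comp_update, Fin.append_left, Fin.append_right,
    Fin.update_append_castAdd, Fin.update_append_natAdd]

/-- The functional induced by the determinant of the basis takes the value 1 on it. -/
theorem exteriorPower.ιMulti_basis_ne_zero {p : ℕ} (b : Module.Basis (Fin p) ℝ V) :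
    exteriorPower.ιMulti ℝ p b ≠ 0 := by
  intro h
  have := exteriorPower.alternatingMapLinearEquiv_apply_ιMulti b.det b
  rw [h, map_zero, b.det_self] at this
  exact zero_ne_one this

end Contraction

/-! ### Local frames and projections of a `2`-web -/

section TwoWeb

open Bundle

variable {E : Type*} [NormedAddCommGroup E] [NormedSpace ℝ E]
  {M : Type*} [TopologicalSpace M] [ChartedSpace E M] [IsManifold 𝓘(ℝ, E) ∞ M]

namespace DivergenceFreeWeb

variable (W : DivergenceFreeWeb E M 2)

theorem dim_eq_codim {i j : Fin 2} (h : j ≠ i) : (W.fol i).dim = (W.fol j).codim := by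
  have h1 := (W.fol i).dim_add_codim
  have h2 := W.sum_codim
  rw [Fin.sum_univ_two] at h2
  fin_cases i <;> fin_cases j <;> simp at h h1 ⊢ <;> omega

theorem finrank_eq_dim_add_dim : Module.finrank ℝ E = (W.fol 0).dim + (W.fol 1).dim := by
  rw [W.dim_eq_codim (i := 0) (j := 1) (by decide), (W.fol 1).dim_add_codim.symm, add_comm]

variable [FiniteDimensional ℝ E]

/-- The vectors of block j of an adapted frame are tangent to Fᵢ because j ≠ i, and there are as
many of them as the dimension of the leaves. -/
theorem exists_localFrame {i j : Fin 2} (h : j ≠ i) (x₀ : M) :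
    ∃ U, IsOpen U ∧ x₀ ∈ U ∧ ∃ Z : Fin (W.fol i).dim → (W.fol i).Field,
      (∀ k, IsSmoothFieldOn (Z k).toVF U) ∧ ∀ x ∈ U,
        ∃ b : Module.Basis (Fin (W.fol i).dim) ℝ ((W.fol i).tangent x), ⇑b = fun k => Z k x := by
  classical
  obtain ⟨U, hx₀, ⟨φ⟩⟩ := W.exists_adaptedFrame x₀
  let ind : Fin (W.fol i).dim → W.Index := fun k => ⟨j, Fin.cast (W.dim_eq_codim h) k⟩
  have hind : Function.Injective ind := fun k l hkl => by simpa [ind] using hkl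
  let Z : Fin (W.fol i).dim → (W.fol i).Field := fun k x =>
    if hx : x ∈ U then ⟨φ.e (ind k) x, φ.e_mem h hx⟩ else 0
  have hZ : ∀ k, ∀ x ∈ U, (Z k).toVF x = φ.e (ind k) x := fun k x hx => by
    simp [Foliation.Field.toVF, Z, hx]
  refine ⟨U, φ.isOpen, hx₀, Z, fun k => (φ.smooth _).congr (hZ k), fun x hx => ?_⟩
  have hli : LinearIndependent ℝ fun k => Z k x := by
    rw [Fintype.linearIndependent_iff]
    intro g hg l
    have h1 : ∑ k, g k • φ.e (ind k) x = 0 := by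
      have := congrArg (Subtype.val) hg
      simpa [← hZ _ x hx, Foliation.Field.toVF] using this
    have h2 := congrArg (φ.ξ (ind l) x) h1
    simpa [φ.dual x hx, hind.eq_iff] using h2
  exact ⟨Module.Basis.mk hli (hli.span_eq_top_of_card_eq_finrank' (by
    rw [Fintype.card_fin, (W.fol i).finrank_tangent])).ge, Module.Basis.coe_mk _ _⟩

theorem compF_add_compG (X : Π x : M, TangentSpace 𝓘(ℝ, E) x) (x : M) :
    X x = (W.compF X).toVF x + (W.compG X).toVF x :=
  (Submodule.projection_add_projection_eq_self (W.isCompl x) (X x)).symm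

theorem smooth_compF {X : Π x : M, TangentSpace 𝓘(ℝ, E) x} {U : Set M} (hU : IsOpen U)
    (hX : IsSmoothFieldOn X U) : IsSmoothFieldOn (W.compF X).toVF U := by
  intro x hx
  obtain ⟨V, hxV, ⟨φ⟩⟩ := W.exists_adaptedFrame x
  have hVU := φ.isOpen.inter hU
  have h1 : IsSmoothFieldOn
      -- Block 1 and not block 0: the forms of block 0 vanish on TF₀, which is therefore spanned by
      -- the vectors of block 1.
      (fun y => ∑ a : W.Index, (if a.1 = 1 then φ.ξ a y (X y) else 0) • φ.e a y) (V ∩ U) := by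
    refine IsSmoothFieldOn.sum fun a _ => IsSmoothFieldOn.smul ?_
      ((φ.smooth a).mono Set.inter_subset_left)
    split_ifs
    · exact φ.smooth_coeff hVU Set.inter_subset_left (hX.mono Set.inter_subset_right) a
    · exact isSmoothFunOn_const 0
  refine ((h1.congr fun y hy => ?_).contMDiffAt hVU ⟨hxV, hx⟩).contMDiffWithinAt
  have h2 : X y = ∑ a : W.Index, (if a.1 = 1 then φ.ξ a y (X y) else 0) • φ.e a y +
      ∑ a : W.Index, (if a.1 = 0 then φ.ξ a y (X y) else 0) • φ.e a y := by
    conv_lhs => rw [← φ.expand y hy.1 (X y)]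
    rw [← Finset.sum_add_distrib]
    refine Finset.sum_congr rfl fun a _ => ?_
    obtain ⟨i, k⟩ := a
    fin_cases i <;> simp
  have hm : ∀ i j : Fin 2, j ≠ i →
      ∑ a : W.Index, (if a.1 = j then φ.ξ a y (X y) else 0) • φ.e a y ∈ (W.fol i).tangent y := by
    refine fun i j hij => Submodule.sum_mem _ fun a _ => ?_
    split_ifs with ha
    · exact Submodule.smul_mem _ _ (φ.e_mem (ha ▸ hij) hy.1)
    · rw [zero_smul]; exact Submodule.zero_mem _
  change ((Submodule.projectionOnto _ _ (W.isCompl y) (X y) : (W.fol 0).tangent y) :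
    TangentSpace 𝓘(ℝ, E) y) = _
  conv_lhs => rw [h2]
  rw [map_add, Submodule.projectionOnto_apply_of_mem_left _ (hm 0 1 (by decide)),
    (Submodule.projectionOnto_apply_eq_zero_iff _).mpr (hm 1 0 (by decide)), add_zero]

theorem smooth_compG {X : Π x : M, TangentSpace 𝓘(ℝ, E) x} {U : Set M} (hU : IsOpen U)
    (hX : IsSmoothFieldOn X U) : IsSmoothFieldOn (W.compG X).toVF U := by
  have h := hX.add (IsSmoothFieldOn.smul (isSmoothFunOn_const (-1)) (W.smooth_compF hU hX))
  refine h.congr fun y _ => ?_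
  rw [W.compF_add_compG X y]
  module

end DivergenceFreeWeb

end TwoWeb

/-! ### The connection induced on `det TF` -/

section InducedConnection

open Bundle

variable {E : Type*} [NormedAddCommGroup E] [NormedSpace ℝ E]
  {M : Type*} [TopologicalSpace M] [ChartedSpace E M] [IsManifold 𝓘(ℝ, E) ∞ M]

theorem Foliation.IsLocalExpr.mono {F : Foliation E M} {η : Π x : M, F.Det x} {U V : Set M}
    {f : M → ℝ} {Y : Fin F.dim → F.Field} (h : F.IsLocalExpr η U f Y) (hV : IsOpen V)
    (hVU : V ⊆ U) : F.IsLocalExpr η V f Y :=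
  ⟨hV, h.smooth_fun.mono hVU, fun j => (h.smooth_field j).mono hVU, fun x hx => h.eq x (hVU hx)⟩

theorem AlternatingMap.eq_of_basis {V : Type*} [AddCommGroup V] [Module ℝ V] {ι : Type*}
    [Fintype ι] [DecidableEq ι] {α β : V [⋀^ι]→ₗ[ℝ] ℝ} (b : Module.Basis ι ℝ V)
    (h : α b = β b) : α = β := by
  rw [← sub_eq_zero, ← AlternatingMap.map_basis_eq_zero_iff b, AlternatingMap.sub_apply, h,
    sub_self]

theorem AlternatingMap.finsetSum_apply {V : Type*} [AddCommGroup V] [Module ℝ V] {ι κ : Type*}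
    (s : Finset κ) (α : κ → V [⋀^ι]→ₗ[ℝ] ℝ) (v : ι → V) : (∑ k ∈ s, α k) v = ∑ k ∈ s, α k v := by
  classical
  induction s using Finset.induction_on with
  | empty => rfl
  | insert k s hk ih => rw [Finset.sum_insert hk, Finset.sum_insert hk, AlternatingMap.add_apply, ih]

/-- Zero torsion gives [X, Y] = Θ_X Y - Θ_Y X, and projection along TF kills the second term. -/
theorem Foliation.bottOn_eq [FiniteDimensional ℝ E] (F G : Foliation E M)
    (h : ∀ x, IsCompl (F.tangent x) (G.tangent x))
    {Θ : CovariantDerivative 𝓘(ℝ, E) E (TangentSpace 𝓘(ℝ, E) : M → Type _)}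
    (hΘ : haveI : CompleteSpace E := FiniteDimensional.complete ℝ E; Θ.torsion = 0)
    {X : F.Field} {Y : G.Field} {x : M}
    (hX : MDifferentiableAt 𝓘(ℝ, E) (𝓘(ℝ, E).prod 𝓘(ℝ, E))
      (fun y => (⟨y, X.toVF y⟩ : TangentBundle 𝓘(ℝ, E) M)) x)
    (hY : MDifferentiableAt 𝓘(ℝ, E) (𝓘(ℝ, E).prod 𝓘(ℝ, E))
      (fun y => (⟨y, Y.toVF y⟩ : TangentBundle 𝓘(ℝ, E) M)) x)
    (hF : Θ X.toVF x (Y x) ∈ F.tangent x) :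
    F.bottOn G h X Y x =
      Submodule.projectionOnto _ _ (h x).symm (Θ Y.toVF x (X.toVF x)) := by
  have : CompleteSpace E := FiniteDimensional.complete ℝ E
  have h1 := Θ.torsion_eq_zero_iff.mp hΘ hX hY
  rw [Foliation.bottOn, Foliation.bott, ← h1, Submodule.mkQ_apply,
    Submodule.quotientEquivOfIsCompl_apply_mk, map_sub]
  change _ - Submodule.projectionOnto _ _ (h x).symm (Θ X.toVF x (Y x)) = _
  rw [(Submodule.projectionOnto_apply_eq_zero_iff (h x).symm).mpr hF, sub_zero]

namespace DivergenceFreeWeb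

variable (W : DivergenceFreeWeb E M 2)

/-- The concatenation of fields tangent to the two foliations. -/
noncomputable def appendField (Y : Fin (W.fol 0).dim → (W.fol 0).Field)
    (Z : Fin (W.fol 1).dim → (W.fol 1).Field) (k : Fin (Module.finrank ℝ E)) :
    Π x : M, TangentSpace 𝓘(ℝ, E) x :=
  Fin.append (fun j => (Y j).toVF) (fun j => (Z j).toVF) (Fin.cast W.finrank_eq_dim_add_dim k)

section

variable {W} {U : Set M} {Y : Fin (W.fol 0).dim → (W.fol 0).Field}
  {Z : Fin (W.fol 1).dim → (W.fol 1).Field}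

theorem appendField_apply (k : Fin (Module.finrank ℝ E)) (x : M) :
    W.appendField Y Z k x = Fin.append (fun j => (Y j x : TangentSpace 𝓘(ℝ, E) x))
      (fun j => (Z j x : TangentSpace 𝓘(ℝ, E) x)) (Fin.cast W.finrank_eq_dim_add_dim k) := by
  unfold appendField
  generalize Fin.cast W.finrank_eq_dim_add_dim k = l
  refine Fin.addCases (fun i => ?_) (fun i => ?_) l <;> simp [Foliation.Field.toVF]

theorem smooth_appendField (hY : ∀ j, IsSmoothFieldOn (Y j).toVF U)
    (hZ : ∀ j, IsSmoothFieldOn (Z j).toVF U) (k : Fin (Module.finrank ℝ E)) :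
    IsSmoothFieldOn (W.appendField Y Z k) U := by
  unfold appendField
  generalize Fin.cast W.finrank_eq_dim_add_dim k = l
  refine Fin.addCases (fun i => ?_) (fun i => ?_) l
  · simpa using hY i
  · simpa using hZ i

end

variable [FiniteDimensional ℝ E]
  (Θ : CovariantDerivative 𝓘(ℝ, E) E (TangentSpace 𝓘(ℝ, E) : M → Type _))

/-- The derivative of `f · Y₁ ∧ ⋯ ∧ Y_d` along `v`, given by the Leibniz rule. -/
noncomputable def leibniz (f : M → ℝ) (Y : Fin (W.fol 0).dim → (W.fol 0).Field) (x : M)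
    (v : TangentSpace 𝓘(ℝ, E) x) : (W.fol 0).Det x :=
  mvfderiv 𝓘(ℝ, E) f x v • exteriorPower.ιMulti ℝ (W.fol 0).dim (fun j => Y j x) +
    f x • ∑ j, exteriorPower.ιMulti ℝ (W.fol 0).dim (Function.update (fun k => Y k x) j
      (Submodule.projectionOnto _ _ (W.isCompl x) (Θ (Y j).toVF x v)))

theorem leibniz_add (f : M → ℝ) (Y : Fin (W.fol 0).dim → (W.fol 0).Field) (x : M)
    (v w : TangentSpace 𝓘(ℝ, E) x) :
    W.leibniz Θ f Y x (v + w) = W.leibniz Θ f Y x v + W.leibniz Θ f Y x w := by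
  simp only [leibniz, map_add, AlternatingMap.map_update_add, Finset.sum_add_distrib, add_smul,
    smul_add]
  abel

variable {Θ}

theorem mu_ιMulti (x : M) (v : Fin (W.fol 0).dim → (W.fol 0).tangent x)
    (w : Fin (W.fol 1).dim → (W.fol 1).tangent x) :
    W.mu x (exteriorPower.ιMulti ℝ (W.fol 0).dim v) w =
      W.vol.toForm x (fun k => Fin.append (fun j => (v j : TangentSpace 𝓘(ℝ, E) x))
        (fun j => (w j : TangentSpace 𝓘(ℝ, E) x)) (Fin.cast W.finrank_eq_dim_add_dim k)) :=
  contraction_ιMulti_cast W.finrank_eq_dim_add_dim _ _ _ v w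

section

variable {W} {U : Set M} {f : M → ℝ} {Y : Fin (W.fol 0).dim → (W.fol 0).Field}
  {Z : Fin (W.fol 1).dim → (W.fol 1).Field}

/-- The projections act as the identity here; they serve only to regard the derivatives as elements
of the subspaces. -/
theorem cov_appendField (k : Fin (Module.finrank ℝ E)) (x : M) (v : TangentSpace 𝓘(ℝ, E) x)
    (hY : ∀ j, Θ (Y j).toVF x v ∈ (W.fol 0).tangent x)
    (hZ : ∀ j, Θ (Z j).toVF x v ∈ (W.fol 1).tangent x) :
    Θ (W.appendField Y Z k) x v =
      Fin.append (fun j => ((Submodule.projectionOnto _ _ (W.isCompl x) (Θ (Y j).toVF x v) :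
          (W.fol 0).tangent x) : TangentSpace 𝓘(ℝ, E) x))
        (fun j => ((Submodule.projectionOnto _ _ (W.isCompl x).symm (Θ (Z j).toVF x v) :
          (W.fol 1).tangent x) : TangentSpace 𝓘(ℝ, E) x))
        (Fin.cast W.finrank_eq_dim_add_dim k) := by
  unfold appendField
  generalize Fin.cast W.finrank_eq_dim_add_dim k = l
  refine Fin.addCases (fun i => ?_) (fun i => ?_) l
  · simp only [Fin.append_left]
    rw [Submodule.projectionOnto_apply_of_mem_left _ (hY i)]
  · simp only [Fin.append_right]
    rw [Submodule.projectionOnto_apply_of_mem_left _ (hZ i)]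

theorem mu_ιMulti_eq_vol (x : M) : W.mu x (exteriorPower.ιMulti ℝ (W.fol 0).dim fun j => Y j x)
    (fun j => Z j x) = W.vol.toForm x (fun k => W.appendField Y Z k x) := by
  rw [mu_ιMulti]
  simp only [appendField_apply]

theorem smooth_mu_ιMulti (hU : IsOpen U) (hY : ∀ j, IsSmoothFieldOn (Y j).toVF U)
    (hZ : ∀ j, IsSmoothFieldOn (Z j).toVF U) :
    IsSmoothFunOn (E := E) (fun x => W.mu x (exteriorPower.ιMulti ℝ (W.fol 0).dim fun j => Y j x)
      (fun j => Z j x)) U :=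
  (W.vol.smooth U hU _ (smooth_appendField hY hZ)).congr fun x _ => mu_ιMulti_eq_vol x

/-- This says that μ is parallel. Since Ω is parallel, the derivative of Ω(Y₁, …, Y_p, Z₁, …, Z_q)
is the sum of the terms where one Yⱼ or one Zⱼ is differentiated; moving the Z-terms to the other
side leaves μ of the derivative of η. -/
theorem mu_leibniz (hΘ : W.IsWebConnection Θ) {η : Π x : M, (W.fol 0).Det x}
    (hη : (W.fol 0).IsLocalExpr η U f Y) (hZ : ∀ j, IsSmoothFieldOn (Z j).toVF U) {x : M}
    (hx : x ∈ U) (v : TangentSpace 𝓘(ℝ, E) x) :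
    W.mu x (W.leibniz Θ f Y x v) (fun j => Z j x) =
      mvfderiv 𝓘(ℝ, E) (fun y => W.mu y (η y) (fun j => Z j y)) x v -
        ∑ j, W.mu x (η x) (Function.update (fun k => Z k x) j
          (Submodule.projectionOnto _ _ (W.isCompl x).symm (Θ (Z j).toVF x v))) := by
  have hY := hη.smooth_field
  have hg := smooth_mu_ιMulti hη.isOpen hY hZ
  have h1 : mvfderiv 𝓘(ℝ, E) (fun y => W.mu y (η y) (fun j => Z j y)) x v =
      f x * mvfderiv 𝓘(ℝ, E) (fun y => W.mu y (exteriorPower.ιMulti ℝ (W.fol 0).dim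
        fun j => Y j y) (fun j => Z j y)) x v +
      mvfderiv 𝓘(ℝ, E) f x v * W.mu x (exteriorPower.ιMulti ℝ (W.fol 0).dim
        fun j => Y j x) (fun j => Z j x) := by
    rw [mvfderiv_congr_of_eqOn (g := f * fun y => W.mu y (exteriorPower.ιMulti ℝ (W.fol 0).dim
        fun j => Y j y) (fun j => Z j y)) hη.isOpen (fun y hy => by
          rw [hη.eq y hy, map_smul]; rfl) hx,
      mvfderiv_mul (hη.smooth_fun.mdiffAt hη.isOpen hx) (hg.mdiffAt hη.isOpen hx)]
    simp [mul_comm]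
  have h2 : mvfderiv 𝓘(ℝ, E) (fun y => W.mu y (exteriorPower.ιMulti ℝ (W.fol 0).dim
        fun j => Y j y) (fun j => Z j y)) x v =
      ∑ j, W.mu x (exteriorPower.ιMulti ℝ (W.fol 0).dim (Function.update (fun k => Y k x) j
        (Submodule.projectionOnto _ _ (W.isCompl x) (Θ (Y j).toVF x v)))) (fun j => Z j x) +
      ∑ j, W.mu x (exteriorPower.ιMulti ℝ (W.fol 0).dim fun k => Y k x)
        (Function.update (fun k => Z k x) j
          (Submodule.projectionOnto _ _ (W.isCompl x).symm (Θ (Z j).toVF x v))) := by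
    rw [show (fun y => W.mu y (exteriorPower.ιMulti ℝ (W.fol 0).dim fun j => Y j y)
        (fun j => Z j y)) = fun y => W.vol.toForm y (fun k => W.appendField Y Z k y) from
        funext mu_ιMulti_eq_vol,
      hΘ.vol_parallel U hη.isOpen _ (smooth_appendField hY hZ) x hx v]
    refine Eq.trans ?_ (sum_update_append W.finrank_eq_dim_add_dim (W.vol.toForm x)
      ((W.fol 0).tangent x) ((W.fol 1).tangent x) (fun k => Y k x) _ (fun k => Z k x) _)
    refine Finset.sum_congr rfl fun k _ => ?_
    rw [cov_appendField k x v
      (fun j => hΘ.fol_parallel 0 U hη.isOpen (Y j) (hY j) x hx v)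
      (fun j => hΘ.fol_parallel 1 U hη.isOpen (Z j) (hZ j) x hx v)]
    simp only [appendField_apply]
  rw [h1, h2, leibniz, hη.eq x hx]
  simp only [map_add, map_smul, map_sum, AlternatingMap.add_apply, AlternatingMap.smul_apply,
    AlternatingMap.finsetSum_apply, smul_eq_mul, ← Finset.mul_sum]
  ring

/-- In `mu_leibniz` the right-hand side involves η but not its local expression. As μ is injective,
the Leibniz formula is independent of that expression, which makes `covDet` well defined. -/
theorem leibniz_eq (hΘ : W.IsWebConnection Θ) {η : Π x : M, (W.fol 0).Det x}
    (hη : (W.fol 0).IsLocalExpr η U f Y) {U' : Set M} {f' : M → ℝ}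
    {Y' : Fin (W.fol 0).dim → (W.fol 0).Field} (hη' : (W.fol 0).IsLocalExpr η U' f' Y') {x : M}
    (hx : x ∈ U) (hx' : x ∈ U') (v : TangentSpace 𝓘(ℝ, E) x) :
    W.leibniz Θ f Y x v = W.leibniz Θ f' Y' x v := by
  obtain ⟨V, hV, hxV, Z, hZ, hb⟩ := W.exists_localFrame (i := 1) (j := 0) (by decide) x
  obtain ⟨b, hb⟩ := hb x hxV
  refine (W.mu x).injective (AlternatingMap.eq_of_basis b ?_)
  have ho := (hη.isOpen.inter hη'.isOpen).inter hV
  have hZ' : ∀ j, IsSmoothFieldOn (Z j).toVF (U ∩ U' ∩ V) := fun j =>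
    (hZ j).mono Set.inter_subset_right
  rw [hb, mu_leibniz hΘ (hη.mono ho fun y hy => hy.1.1) hZ' ⟨⟨hx, hx'⟩, hxV⟩,
    mu_leibniz hΘ (hη'.mono ho fun y hy => hy.1.2) hZ' ⟨⟨hx, hx'⟩, hxV⟩]

end

/-! ### Smooth sections -/

variable {W}

theorem isSmoothDetDual_mu {η : Π x : M, (W.fol 0).Det x} (hη : (W.fol 0).IsSmoothDet η) :
    (W.fol 1).IsSmoothDetDual fun x => W.mu x (η x) := by
  intro U hU Z hZ x hx
  obtain ⟨V, f, Y, hxV, h⟩ := hη x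
  have ho := hU.inter h.isOpen
  have h1 := (h.smooth_fun.mono (Set.inter_subset_right (s := U))).mul
    (smooth_mu_ιMulti ho (fun j => (h.smooth_field j).mono Set.inter_subset_right)
      (fun j => (hZ j).mono Set.inter_subset_left))
  refine ((h1.congr (g := fun x => W.mu x (η x) (fun j => Z j x)) fun y hy => ?_).contMDiffAt
    (ho.mem_nhds ⟨hx, hxV⟩)).contMDiffWithinAt
  rw [h.eq y hy.2, map_smul]
  rfl

theorem isSmoothDet_mu_symm {α : Π x : M, (W.fol 1).DetDual x}
    (hα : (W.fol 1).IsSmoothDetDual α) :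
    (W.fol 0).IsSmoothDet fun x => (W.mu x).symm (α x) := by
  intro x₀
  obtain ⟨U, hU, hxU, Y, hY, hbY⟩ := W.exists_localFrame (i := 0) (j := 1) (by decide) x₀
  obtain ⟨V, hV, hxV, Z, hZ, hbZ⟩ := W.exists_localFrame (i := 1) (j := 0) (by decide) x₀
  have ho := hU.inter hV
  have hY' : ∀ j, IsSmoothFieldOn (Y j).toVF (U ∩ V) := fun j =>
    (hY j).mono Set.inter_subset_left
  have hZ' : ∀ j, IsSmoothFieldOn (Z j).toVF (U ∩ V) := fun j =>
    (hZ j).mono Set.inter_subset_right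
  have hne : ∀ x ∈ U ∩ V, W.mu x (exteriorPower.ιMulti ℝ (W.fol 0).dim fun j => Y j x)
      (fun j => Z j x) ≠ 0 := by
    intro x hx h0
    obtain ⟨b, hb⟩ := hbY x hx.1
    obtain ⟨c, hc⟩ := hbZ x hx.2
    rw [← hb, ← hc, AlternatingMap.map_basis_eq_zero_iff, LinearEquiv.map_eq_zero_iff] at h0
    exact exteriorPower.ιMulti_basis_ne_zero b h0
  -- Both bundles have rank one, so the coefficient is the quotient of the values of α and of μ(Y₁ ∧
  -- ⋯ ∧ Y_p) on one frame Z of TG.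
  refine ⟨U ∩ V, fun x => α x (fun j => Z j x) /
    W.mu x (exteriorPower.ιMulti ℝ (W.fol 0).dim fun j => Y j x) (fun j => Z j x), Y,
    ⟨hxU, hxV⟩, ho, (hα _ ho Z hZ').div (smooth_mu_ιMulti ho hY' hZ') hne, hY', fun x hx => ?_⟩
  obtain ⟨c, hc⟩ := hbZ x hx.2
  rw [LinearEquiv.symm_apply_eq, map_smul]
  refine AlternatingMap.eq_of_basis c ?_
  rw [hc, AlternatingMap.smul_apply, smul_eq_mul, div_mul_cancel₀ _ (hne x hx)]

/-! ### The induced connection is Tabachnikov's connection -/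

variable (W Θ) in
open Classical in
/-- The connection on `det TF` induced by the affine connection `Θ`. -/
noncomputable def covDet (X : Π x : M, TangentSpace 𝓘(ℝ, E) x) (η : Π x : M, (W.fol 0).Det x)
    (x : M) : (W.fol 0).Det x :=
  if h : ∃ p : Set M × (M → ℝ) × (Fin (W.fol 0).dim → (W.fol 0).Field),
      x ∈ p.1 ∧ (W.fol 0).IsLocalExpr η p.1 p.2.1 p.2.2 then
    W.leibniz Θ h.choose.2.1 h.choose.2.2 x (X x)
  else 0

theorem covDet_eq (hΘ : W.IsWebConnection Θ) (X : Π x : M, TangentSpace 𝓘(ℝ, E) x)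
    {η : Π x : M, (W.fol 0).Det x} {U : Set M} {f : M → ℝ}
    {Y : Fin (W.fol 0).dim → (W.fol 0).Field} (hη : (W.fol 0).IsLocalExpr η U f Y) {x : M}
    (hx : x ∈ U) : W.covDet Θ X η x = W.leibniz Θ f Y x (X x) := by
  have h : ∃ p : Set M × (M → ℝ) × (Fin (W.fol 0).dim → (W.fol 0).Field),
      x ∈ p.1 ∧ (W.fol 0).IsLocalExpr η p.1 p.2.1 p.2.2 := ⟨(U, f, Y), hx, hη⟩
  rw [covDet, dif_pos h]
  exact leibniz_eq hΘ h.choose_spec.2 hη h.choose_spec.1 hx _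

theorem isBottDet_covDet (hΘ : W.IsWebConnection Θ) :
    (W.fol 1).IsBottDet (W.fol 0) (fun x => (W.isCompl x).symm)
      fun X η => W.covDet Θ X.toVF η := by
  intro X η hX _ U f Y hY x hx
  dsimp only
  rw [covDet_eq hΘ _ hY hx, leibniz, lieDer]
  congr 3
  funext j
  rw [Foliation.bottOn_eq _ _ _ hΘ.torsionless (hX.mdiffAt isOpen_univ (Set.mem_univ x))
    ((hY.smooth_field j).mdiffAt hY.isOpen hx)
    (hΘ.fol_parallel 1 _ isOpen_univ X hX x (Set.mem_univ x) _)]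

/-- The operator on det T*G is `covDet` transported by μ; by `mu_leibniz` it is the dual action of
Θ, which along F is Bott's. -/
theorem isBottDetDual_covDet (hΘ : W.IsWebConnection Θ) :
    (W.fol 0).IsBottDetDual (W.fol 1) W.isCompl
      fun X α x => W.mu x (W.covDet Θ X.toVF (fun y => (W.mu y).symm (α y)) x) := by
  intro X α hX hα U hU Z hZ x hx
  dsimp only
  obtain ⟨V, f, Y, hxV, h⟩ := isSmoothDet_mu_symm hα x
  have h' := h.mono (hU.inter h.isOpen) Set.inter_subset_right
  rw [covDet_eq hΘ _ h' ⟨hx, hxV⟩,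
    mu_leibniz hΘ h' (fun j => (hZ j).mono Set.inter_subset_left) ⟨hx, hxV⟩]
  simp only [LinearEquiv.apply_symm_apply]
  rw [lieDer]
  congr 2
  funext j
  rw [Foliation.bottOn_eq _ _ _ hΘ.torsionless (hX.mdiffAt isOpen_univ (Set.mem_univ x))
    ((hZ j).mdiffAt hU hx)
    (hΘ.fol_parallel 0 _ isOpen_univ X hX x (Set.mem_univ x) _)]

/-- With D^F of the form μ ∘ `covDet` ∘ μ⁻¹, the outer μ⁻¹ and μ cancel, and the two remaining terms
are the derivatives of η along X_F and X_G. -/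
theorem isTabachnikovConnection_covDet (hΘ : W.IsWebConnection Θ) :
    W.IsTabachnikovConnection (W.covDet Θ) := by
  refine ⟨_, _, isBottDetDual_covDet hΘ, isBottDet_covDet hΘ, fun X η _ hη x => ?_⟩
  obtain ⟨U, f, Y, hx, h⟩ := hη x
  simp only [LinearEquiv.symm_apply_apply]
  rw [covDet_eq hΘ _ h hx, covDet_eq hΘ _ h hx, covDet_eq hΘ _ h hx, ← leibniz_add,
    ← compF_add_compG]

/-- The Leibniz rules prescribe D^F and D^G on smooth sections, with no reference to an affine
connection. This is the source of the independence from Θ. -/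
theorem IsTabachnikovConnection.unique
    {D D' : (Π x : M, TangentSpace 𝓘(ℝ, E) x) → (Π x : M, (W.fol 0).Det x) →
      Π x : M, (W.fol 0).Det x}
    (hD : W.IsTabachnikovConnection D) (hD' : W.IsTabachnikovConnection D')
    {X : Π x : M, TangentSpace 𝓘(ℝ, E) x} {η : Π x : M, (W.fol 0).Det x}
    (hX : IsSmoothFieldOn X Set.univ) (hη : (W.fol 0).IsSmoothDet η) : D X η = D' X η := by
  obtain ⟨DF, DG, hF, hG, h⟩ := hD
  obtain ⟨DF', DG', hF', hG', h'⟩ := hD'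
  funext x
  obtain ⟨U, f, Y, hx, he⟩ := hη x
  obtain ⟨V, hV, hxV, Z, hZ, hb⟩ := W.exists_localFrame (i := 1) (j := 0) (by decide) x
  obtain ⟨b, hb⟩ := hb x hxV
  have hXF := W.smooth_compF isOpen_univ hX
  have hXG := W.smooth_compG isOpen_univ hX
  have hμ := isSmoothDetDual_mu hη
  rw [h X η hX hη x, h' X η hX hη x, hG _ η hXG hη U f Y he x hx, hG' _ η hXG hη U f Y he x hx]
  congr 2
  refine AlternatingMap.eq_of_basis b ?_
  rw [hb, hF _ _ hXF hμ V hV Z hZ x hxV, hF' _ _ hXF hμ V hV Z hZ x hxV]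

end DivergenceFreeWeb

end InducedConnection

/-! ### The natural connection -/

section NaturalConnection

theorem Foliation.isLocalExpr_zero {E : Type*} [NormedAddCommGroup E] [NormedSpace ℝ E] {M : Type*}
    [TopologicalSpace M] [ChartedSpace E M] [IsManifold 𝓘(ℝ, E) ∞ M] (F : Foliation E M) :
    F.IsLocalExpr (fun _ => 0) Set.univ (fun _ => 0) (fun _ _ => 0) :=
  ⟨isOpen_univ, isSmoothFunOn_const 0, fun _ => IsSmoothFieldOn.zero, fun _ _ => by simp⟩
variable {E : Type*} [NormedAddCommGroup E] [NormedSpace ℝ E] [FiniteDimensional ℝ E]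
  {M : Type*} [TopologicalSpace M] [ChartedSpace E M] [IsManifold 𝓘(ℝ, E) ∞ M] {n : ℕ}

namespace DivergenceFreeWeb

variable {W : DivergenceFreeWeb E M n}
  {Θ : CovariantDerivative 𝓘(ℝ, E) E (TangentSpace 𝓘(ℝ, E) : M → Type _)}

/-- TFᵢᶜ is an intersection of parallel distributions. -/
theorem IsWebConnection.mem_compl (hΘ : W.IsWebConnection Θ) {i : Fin n} {U : Set M}
    (hU : IsOpen U) {Y : (W.compl i).Field} (hY : IsSmoothFieldOn Y.toVF U) {x : M} (hx : x ∈ U)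
    (v : TangentSpace 𝓘(ℝ, E) x) : Θ Y.toVF x v ∈ (W.compl i).tangent x :=
  (Submodule.mem_iInf _).mpr fun j => hΘ.fol_parallel j U hU
    (fun y => ⟨Y y, (Submodule.mem_iInf _).mp (Y y).2 j⟩) hY x hx v

theorem IsWebConnection.twoWeb (hΘ : W.IsWebConnection Θ) (i : Fin n) :
    (W.twoWeb i).IsWebConnection Θ where
  smooth := hΘ.smooth
  torsionless := hΘ.torsionless
  vol_parallel := hΘ.vol_parallel
  fol_parallel k U hU := by
    refine Fin.cases ?_ (fun k => ?_) k
    · exact fun Y hY x hx v => hΘ.mem_compl (i := i) (Y := Y) hU hY hx v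
    · obtain rfl : k = 0 := Subsingleton.elim _ _
      exact hΘ.fol_parallel i U hU

theorem IsWebConnection.map_covDet (hΘ : W.IsWebConnection Θ) (i : Fin n)
    (X : Π x : M, TangentSpace 𝓘(ℝ, E) x) {η : Π x : M, (W.compl i).Det x} {U : Set M} {f : M → ℝ}
    {Y : Fin (W.compl i).dim → (W.compl i).Field} (hη : (W.compl i).IsLocalExpr η U f Y) {x : M}
    (hx : x ∈ U) :
    exteriorPower.map (W.compl i).dim ((W.compl i).tangent x).subtype
        ((W.twoWeb i).covDet Θ X η x) =
      lieDer X f x • exteriorPower.ιMulti ℝ (W.compl i).dim (fun j => (Y j).toVF x) +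
        f x • ∑ j, exteriorPower.ιMulti ℝ (W.compl i).dim
          (Function.update (fun k => (Y k).toVF x) j (Θ (Y j).toVF x (X x))) := by
  have h1 : (W.twoWeb i).covDet Θ X η x = lieDer X f x •
        exteriorPower.ιMulti ℝ (W.compl i).dim (fun j => Y j x) +
      f x • ∑ j, exteriorPower.ιMulti ℝ (W.compl i).dim (Function.update (fun k => Y k x) j
        (Submodule.projectionOnto _ _ (W.isCompl_compl i x) (Θ (Y j).toVF x (X x)))) :=
    covDet_eq (W := W.twoWeb i) (hΘ.twoWeb i) X hη hx
  rw [h1, map_add, map_smul, map_smul, map_sum, exteriorPower.map_apply_ιMulti]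
  congr 2
  refine Finset.sum_congr rfl fun j _ => ?_
  rw [exteriorPower.map_apply_ιMulti]
  congr 1
  refine (Submodule.coe_comp_update _ _ _).trans ?_
  rw [Submodule.projectionOnto_apply_of_mem_left _
    (hΘ.mem_compl hη.isOpen (hη.smooth_field j) hx _)]
  rfl

/-- `IsInducedBy` prescribes N only as a multivector in TM. Over a field the exterior power of an
injective map is injective, so this determines N in det TFᵢᶜ. -/
theorem IsInducedBy.apply_eq_covDet (hΘ : W.IsWebConnection Θ)
    {N : (Π x : M, TangentSpace 𝓘(ℝ, E) x) → (Π x : M, W.DetSum x) → Π x : M, W.DetSum x}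
    (hN : W.IsInducedBy Θ N) {X : Π x : M, TangentSpace 𝓘(ℝ, E) x} {s : Π x : M, W.DetSum x}
    (hX : IsSmoothFieldOn X Set.univ) (hs : ∀ i, (W.compl i).IsSmoothDet (fun x => s x i))
    (x : M) (i : Fin n) :
    N X s x i = (W.twoWeb i).covDet Θ X (fun x => s x i) x := by
  obtain ⟨U, f, Y, hx, h⟩ := hs i x
  refine exteriorPower.map_injective_field
    (LinearMap.ker_eq_bot.mp (Submodule.ker_subtype ((W.compl i).tangent x))) ?_
  rw [hN X s hX hs i U f Y h x hx]
  exact (hΘ.map_covDet i X h hx).symm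

/-- N is built from one Θ₀. Any other Θ induces the same operator, both being Tabachnikov's
connection of the same `2`-webs. -/
theorem exists_isNaturalConnection [T2Space M] [SigmaCompactSpace M] :
    ∃ N, W.IsNaturalConnection N := by
  obtain ⟨Θ₀, hΘ₀⟩ := W.exists_isWebConnection
  refine ⟨fun X s x i => (W.twoWeb i).covDet Θ₀ X (fun x => s x i) x, ⟨Θ₀, hΘ₀⟩,
    fun Θ hΘ X s hX hs i U f Y h x hx => ?_⟩
  refine Eq.trans ?_ (hΘ.map_covDet i X h hx)
  exact congrArg _ (congrFun ((isTabachnikovConnection_covDet (hΘ₀.twoWeb i)).unique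
    (isTabachnikovConnection_covDet (hΘ.twoWeb i)) hX (hs i)) x)

theorem incl_apply_same (i : Fin n) (η : Π x : M, (W.compl i).Det x) (x : M) :
    W.incl i η x i = η x := by
  simp [incl]

theorem incl_apply_of_ne {i j : Fin n} (h : j ≠ i) (η : Π x : M, (W.compl i).Det x) (x : M) :
    W.incl i η x j = 0 := by
  simp [incl, h]

theorem covDet_zero {W : DivergenceFreeWeb E M 2} (hΘ : W.IsWebConnection Θ)
    (X : Π x : M, TangentSpace 𝓘(ℝ, E) x) (x : M) : W.covDet Θ X (fun _ => 0) x = 0 := by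
  rw [covDet_eq hΘ X (Foliation.isLocalExpr_zero _) (Set.mem_univ x), leibniz]
  simp [mvfderiv_const]

end DivergenceFreeWeb

end NaturalConnection

theorem mainTheorem11 {E : Type*} [NormedAddCommGroup E] [NormedSpace ℝ E] [FiniteDimensional ℝ E]
    {M : Type*} [TopologicalSpace M] [T2Space M] [SigmaCompactSpace M] [ChartedSpace E M]
    [IsManifold 𝓘(ℝ, E) ∞ M] {n : ℕ} (W : DivergenceFreeWeb E M n) :
    (∃ N, W.IsNaturalConnection N) ∧
    ∀ N, W.IsNaturalConnection N → ∀ i : Fin n,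
      (∃ D, (W.twoWeb i).IsTabachnikovConnection D) ∧
      ∀ D : (Π x : M, TangentSpace 𝓘(ℝ, E) x) → (Π x : M, (W.compl i).Det x) →
          Π x : M, (W.compl i).Det x,
        (W.twoWeb i).IsTabachnikovConnection D →
        ∀ (X : Π x : M, TangentSpace 𝓘(ℝ, E) x) (η : Π x : M, (W.compl i).Det x),
          IsSmoothFieldOn X Set.univ → (W.compl i).IsSmoothDet η →
          N X (W.incl i η) = W.incl i (D X η) := by
  refine ⟨DivergenceFreeWeb.exists_isNaturalConnection, fun N hN i => ?_⟩
  obtain ⟨⟨Θ, hΘ⟩, hN⟩ := hN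
  have hT := DivergenceFreeWeb.isTabachnikovConnection_covDet (hΘ.twoWeb i)
  refine ⟨⟨_, hT⟩, fun D hD X η hX hη => ?_⟩
  have hi : (fun x => W.incl i η x i) = η := funext fun x =>
    DivergenceFreeWeb.incl_apply_same i η x
  have hj : ∀ j, j ≠ i → (fun x => W.incl i η x j) = fun _ => 0 := fun j hj =>
    funext fun x => DivergenceFreeWeb.incl_apply_of_ne hj η x
  have hs : ∀ j, (W.compl j).IsSmoothDet (fun x => W.incl i η x j) := by
    intro j
    by_cases h : j = i
    · subst h
      rwa [hi]
    · rw [hj j h]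
      exact fun x => ⟨_, _, _, Set.mem_univ x, Foliation.isLocalExpr_zero _⟩
  funext x j
  -- For j = i, uniqueness of Tabachnikov's connection identifies `covDet` with D. For j ≠ i the
  -- component is the zero section, whose derivative is zero.
  rw [(hN Θ hΘ).apply_eq_covDet hΘ hX hs x j]
  by_cases h : j = i
  · subst h
    rw [hi]
    refine Eq.trans ?_ (DivergenceFreeWeb.incl_apply_same j (D X η) x).symm
    exact congrFun (hT.unique hD hX hη) x
  · rw [hj j h]
    exact (DivergenceFreeWeb.covDet_zero (hΘ.twoWeb j) X x).trans
      (DivergenceFreeWeb.incl_apply_of_ne h (D X η) x).symm
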